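/- Fix $g>0$. A point particle moves in $\mathcal Q=\{(\theta,y):y\ge|\sin\theta|\}$ with $\ddot\theta=0$, $\ddot y=-g$, at energy $E=\tfrac12\dot\theta^2+\tfrac12\dot y^2+gy$, and is reflected elastically (mirror law) at $\partial\mathcal Q$. Let $\mathcal P_d$ be the set of $(\theta,\dot\theta)$ with $2E-2g|\sin\theta|-\dot\theta^2>0$; such a pair stands for a collision at $(\theta,|\sin\theta|)$ with incoming velocity $(\dot\theta,-\sqrt{2E-2g|\sin\theta|-\dot\theta^2})$. Let $f$ be the return map, $f(\theta,\dot\theta)=(\theta_1,\dot\theta_1)$, which takes the data of a collision in $\mathcal P_d$ to the data of the next collision, when this is again in $\mathcal P_d$. For $\sin\theta\ne0$ write $$\dot\theta_+=\frac{1}{1+\cos^2\theta}\Big(\dot\theta\sin^2\theta-2\sqrt{2E-2g|\sin\theta|-\dot\theta^2}\,\cos\theta\,\frac{\sin\theta}{|\sin\theta|}\Big)$$ for the angular velocity right after the reflection, let $a=(\theta^a,\dot\theta^a)=\big(\tfrac\pi2-\tfrac kE,\tfrac{\sqrt2k}{\sqrt E}\big)$, and put $$A(E,k)=\frac2g\,\dot\theta^a_+\sqrt{2E-2g|\sin\theta^a|-(\dot\theta^a_+)^2}+\pi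 .$$ Put $$D_L=\Big\{(\theta,\dot\theta)\in\mathcal P_d:\big|\theta-\tfrac\pi2\big|\le\tfrac kE,\ |\dot\theta|\le\tfrac{\sqrt2k}{\sqrt E}\Big\},\qquad D_R=\Big\{(\theta,\dot\theta)\in\mathcal P_d:\big|\theta-\tfrac{3\pi}2\big|\le\tfrac kE,\ |\dot\theta|\le\tfrac{\sqrt2k}{\sqrt E}\Big\},$$ $D=D_L\cup D_R$ and $\mathcal D=\bigcup_{n\in\mathbb Z}\big(D+(2\pi n,0)\big)$. A $\mu$-horizontal strip in a rectangle $[X_0,X_1]\times[Y_0,Y_1]$ is a set $\{(X,Y):X_0\le X\le X_1,\ h_1(X)\le Y\le h_2(X)\}$, where $h_1<h_2$ are $\mu$-Lipschitz functions $[X_0,X_1]\to[Y_0,Y_1]$. Proposition 4.5. Let $0<k_1<k_2$. There are constants $C,E_0>0$, depending only on $g,k_1,k_2$, such that for every $E\ge E_0$ the following holds. There is a $k\in(\tfrac{g\pi}8,\tfrac{g\pi}2)$ with $A(E,k)=0$; and for every $k\in(k_1,k_2)$ with $A(E,k)=0$, the map $f$ is defined on all of $D$, and $f(D)\cap\mathcal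 D$ is the union of six pairwise disjoint $\mu_h$-horizontal strips with $0\le\mu_h\le C/\sqrt E$. More precisely, $f(D_L)\cap\mathcal D$ is the union of three of the strips, one in each of the rectangles $D_R-(2\pi,0)$, $D_L$, $D_R$, and $f(D_R)\cap\mathcal D$ is the union of the other three, one in each of $D_L$, $D_R$, $D_L+(2\pi,0)$. -/

import Mathlib

namespace CoinBilliard

/-- The lower half `P_d` of the Poincare section at energy `E`, in the coordinates
`p = (θ, θ')` (footpoint `(θ, |sin θ|)` on the boundary, incoming velocity
`(θ', -√(2E - 2g|sin θ| - θ'^2))`): the points whose incoming vertical velocity is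
well defined and negative. -/
def sectionDown (g E : ℝ) : Set (ℝ × ℝ) :=
  {p | 0 < 2 * E - 2 * g * |Real.sin p.1| - p.2 ^ 2}

/-- The incoming vertical velocity at a point of `P_d`. -/
noncomputable def vertIn (g E : ℝ) (p : ℝ × ℝ) : ℝ :=
  -Real.sqrt (2 * E - 2 * g * |Real.sin p.1| - p.2 ^ 2)

/-- The angular velocity right after the mirror reflection of the incoming velocity at the
boundary point `(θ, |sin θ|)` (with `sin θ ≠ 0`). -/
noncomputable def angOut (g E : ℝ) (p : ℝ × ℝ) : ℝ :=
  (Real.sin p.1 ^ 2 * p.2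
    + 2 * Real.cos p.1 * (Real.sin p.1 / |Real.sin p.1|) * vertIn g E p)
    / (1 + Real.cos p.1 ^ 2)

/-- The vertical velocity right after the mirror reflection. -/
noncomputable def vertOut (g E : ℝ) (p : ℝ × ℝ) : ℝ :=
  (2 * Real.cos p.1 * (Real.sin p.1 / |Real.sin p.1|) * p.2
    - Real.sin p.1 ^ 2 * vertIn g E p)
    / (1 + Real.cos p.1 ^ 2)

/-- The graph of the return map `f`: `f p = q`. After the reflection at `p` the particle moves
along the parabola `(θ + θ'₊ s, |sin θ| + y'₊ s - g s^2 / 2)`, stays strictly above the boundary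
for `0 < s < t`, and at time `t` it is at the boundary point described by `q`, arriving with
the velocity described by `q`. -/
def IsReturn (g E : ℝ) (p q : ℝ × ℝ) : Prop :=
  p ∈ sectionDown g E ∧ Real.sin p.1 ≠ 0 ∧ q ∈ sectionDown g E ∧
  ∃ t : ℝ, 0 < t ∧
    (∀ s : ℝ, 0 < s → s < t →
      |Real.sin (p.1 + angOut g E p * s)|
        < |Real.sin p.1| + vertOut g E p * s - g * s ^ 2 / 2) ∧
    q.1 = p.1 + angOut g E p * t ∧
    |Real.sin q.1| = |Real.sin p.1| + vertOut g E p * t - g * t ^ 2 / 2 ∧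
    q.2 = angOut g E p ∧
    vertIn g E q = vertOut g E p - g * t

/-- The image `f(S)` under the return map. -/
def returnImage (g E : ℝ) (S : Set (ℝ × ℝ)) : Set (ℝ × ℝ) :=
  {q | ∃ p ∈ S, IsReturn g E p q}

/-- The function `A(E, k)` whose zero defines `k = k(E)`. -/
noncomputable def cornerEq (g E k : ℝ) : ℝ :=
  let a : ℝ × ℝ := (Real.pi / 2 - k / E, Real.sqrt 2 * k / Real.sqrt E)
  2 / g * (angOut g E a *
    Real.sqrt (2 * E - 2 * g * |Real.sin a.1| - angOut g E a ^ 2)) + Real.pi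

/-- The rectangle `D_L`. -/
def domL (g E k : ℝ) : Set (ℝ × ℝ) :=
  {p | p ∈ sectionDown g E ∧ |p.1 - Real.pi / 2| ≤ k / E ∧
    |p.2| ≤ Real.sqrt 2 * k / Real.sqrt E}

/-- The rectangle `D_R`. -/
def domR (g E k : ℝ) : Set (ℝ × ℝ) :=
  {p | p ∈ sectionDown g E ∧ |p.1 - 3 * Real.pi / 2| ≤ k / E ∧
    |p.2| ≤ Real.sqrt 2 * k / Real.sqrt E}

/-- `D = D_L ∪ D_R`. -/
def dom (g E k : ℝ) : Set (ℝ × ℝ) := domL g E k ∪ domR g E k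

/-- The union of all translates of `D` by `(2πn, 0)`, `n ∈ ℤ`. -/
def domTranslates (g E k : ℝ) : Set (ℝ × ℝ) :=
  ⋃ n : ℤ, (fun p : ℝ × ℝ => (p.1 + 2 * Real.pi * (n : ℝ), p.2)) '' dom g E k

/-- `h` defines a `μ`-horizontal curve in `[X₀, X₁] × [Y₀, Y₁]`. -/
def IsHorizontalCurve (μ X₀ X₁ Y₀ Y₁ : ℝ) (h : ℝ → ℝ) : Prop :=
  (∀ X ∈ Set.Icc X₀ X₁, h X ∈ Set.Icc Y₀ Y₁) ∧
  ∀ X ∈ Set.Icc X₀ X₁, ∀ X' ∈ Set.Icc X₀ X₁, |h X - h X'| ≤ μ * |X - X'|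

/-- `H` is a `μ`-horizontal strip in `[X₀, X₁] × [Y₀, Y₁]`: the closed region between two
non-intersecting `μ`-horizontal curves `h₁ < h₂`, across the whole rectangle. -/
def IsHorizontalStrip (μ X₀ X₁ Y₀ Y₁ : ℝ) (H : Set (ℝ × ℝ)) : Prop :=
  ∃ h₁ h₂ : ℝ → ℝ,
    IsHorizontalCurve μ X₀ X₁ Y₀ Y₁ h₁ ∧ IsHorizontalCurve μ X₀ X₁ Y₀ Y₁ h₂ ∧
    (∀ X ∈ Set.Icc X₀ X₁, h₁ X < h₂ X) ∧
    H = {p | p.1 ∈ Set.Icc X₀ X₁ ∧ p.2 ∈ Set.Icc (h₁ p.1) (h₂ p.1)}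

/-- The angular centres of the rectangles crossed by the six strips: `D_R - (2π, 0)`, `D_L`,
`D_R` (crossed by the image of `D_L`), then `D_L`, `D_R`, `D_L + (2π, 0)` (crossed by the image
of `D_R`). -/
noncomputable def stripCentre : Fin 6 → ℝ :=
  ![-Real.pi / 2, Real.pi / 2, 3 * Real.pi / 2,
    Real.pi / 2, 3 * Real.pi / 2, 5 * Real.pi / 2]

end CoinBilliard

namespace CoinBilliard

/-! Measure angles from the maxima of |sin θ| and put L = √(2E), ε = k/E, w = εL. The components of
D and their translates are the rectangles |x| ≤ ε, |v| ≤ w about these maxima. By conservation of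
energy a flight with angular velocity Y from offset x to offset ξ takes the time (S(x, Y) + S(ξ,
Y))/g with S = `vertSpeed`. So f sends (x, v) to (ξ, Y), j maxima further on, exactly when Y =
`angRefl` x v and `flight` x ξ Y = jπ (`isReturn_centre_iff`); at high energy the vertical speed is
so large that the boundary is not met in between.

Both functions are monotone: `angRefl` increases in x and in v, while `flight` increases in x,
decreases in ξ and increases in Y at rate at least L/g. Hence the part of the image in a target
rectangle is bounded by the images of the bottom and the top side, which are graphs over ξ of slope
O(1/L), provided that these images cross the target (`isHorizontalStrip_imagePart`).

The equation A(E, k) = 0 says that the corner (-ε, w) lands on the left side of the rectangle at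
distance -π. With `pi_add_le_of_corner` and the symmetry (x, v) ↦ (-x, -v) this yields the crossings
at distances -π, 0 and π (`isHorizontalStrip_of_corner`); all others are out of reach
(`abs_flight_lt_two_pi`). Two sources with three targets each give six strips. To leading order A is
π - 4k/g, so it changes sign near k = gπ/4. -/

/-- The vertical speed at height `cos x` and angular velocity `Y`, where `L ^ 2 = 2 * E`. -/
noncomputable def vertSpeed (g L x Y : ℝ) : ℝ := Real.sqrt (L ^ 2 - 2 * g * Real.cos x - Y ^ 2)

/-- The angular velocity after a reflection at angular distance `x` from a maximum of `|sin|`. -/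
noncomputable def angRefl (g L x v : ℝ) : ℝ :=
  (Real.cos x ^ 2 * v + 2 * Real.sin x * vertSpeed g L x v) / (1 + Real.sin x ^ 2)

/-- The vertical velocity after a reflection at angular distance `x` from a maximum of `|sin|`. -/
noncomputable def vertRefl (g L x v : ℝ) : ℝ :=
  (Real.cos x ^ 2 * vertSpeed g L x v - 2 * Real.sin x * v) / (1 + Real.sin x ^ 2)

/-- The angular distance between the maxima of `|sin|` near which a flight with angular velocity
`Y` starts and ends, if it starts at offset `x` and ends at offset `ξ` from these maxima. -/
noncomputable def flight (g L x ξ Y : ℝ) : ℝ :=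
  x - ξ + Y * (vertSpeed g L x Y + vertSpeed g L ξ Y) / g

/-! ### Elementary bounds for sine and cosine. -/

theorem abs_sin_le_half {x : ℝ} (hx : |x| ≤ 1 / 2) : |Real.sin x| ≤ 1 / 2 := by
  exact Real.abs_sin_le_abs.trans hx

theorem cos_ge_of_abs_le_half {x : ℝ} (hx : |x| ≤ 1 / 2) : 7 / 8 ≤ Real.cos x := by
  have h := Real.one_sub_sq_div_two_le_cos (x := x)
  have := sq_le_sq' (abs_le.1 hx).1 (abs_le.1 hx).2
  linarith

theorem half_sub_le_sin_sub_sin {x x' : ℝ} (hx : |x| ≤ 1 / 2) (hx' : |x'| ≤ 1 / 2)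
    (h : x ≤ x') : (x' - x) / 2 ≤ Real.sin x' - Real.sin x := by
  rcases h.eq_or_lt with rfl | h
  · simp
  rw [abs_le] at hx hx'
  rw [Real.sin_sub_sin]
  have h1 : (x' - x) / 2 - ((x' - x) / 2) ^ 3 / 6 < Real.sin ((x' - x) / 2) :=
    Real.sin_gt_sub_cube (by linarith)
  have h2 : 7 / 8 ≤ Real.cos ((x' + x) / 2) :=
    cos_ge_of_abs_le_half (abs_le.2 ⟨by linarith, by linarith⟩)
  set d := (x' - x) / 2 with hd
  have hd0 : 0 < d := by rw [hd]; linarith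
  have hd1 : d ≤ 1 / 2 := by rw [hd]; linarith
  have h3 : d * (3 / 4) ≤ Real.sin d := by nlinarith [mul_pos hd0 hd0]
  nlinarith

/-! ### Monotonicity and Lipschitz estimates for speed, reflection and flight. -/

section Speed

variable {g L : ℝ}

/-- The hypothesis 100(1 + g) ≤ L is the high-energy assumption used throughout; it also makes 2/L
and 2g/L at most 1/50. -/
theorem vertSpeed_radicand_ge (hg : 0 < g) (hL : 100 * (1 + g) ≤ L) (x : ℝ) {Y : ℝ}
    (hY : |Y| ≤ 1) : (19 / 20 * L) ^ 2 ≤ L ^ 2 - 2 * g * Real.cos x - Y ^ 2 := by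
  have h1 : Y ^ 2 ≤ 1 := by simpa using sq_le_sq' (abs_le.1 hY).1 (abs_le.1 hY).2
  have h2 : g * Real.cos x ≤ g := by nlinarith [Real.cos_le_one x]
  nlinarith

theorem vertSpeed_sq (hg : 0 < g) (hL : 100 * (1 + g) ≤ L) (x : ℝ) {Y : ℝ}
    (hY : |Y| ≤ 1) : vertSpeed g L x Y ^ 2 = L ^ 2 - 2 * g * Real.cos x - Y ^ 2 :=
  Real.sq_sqrt ((sq_nonneg _).trans (vertSpeed_radicand_ge hg hL x hY))

theorem vertSpeed_ge (hg : 0 < g) (hL : 100 * (1 + g) ≤ L) (x : ℝ) {Y : ℝ}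
    (hY : |Y| ≤ 1) : 19 / 20 * L ≤ vertSpeed g L x Y :=
  Real.le_sqrt_of_sq_le (vertSpeed_radicand_ge hg hL x hY)

theorem vertSpeed_le (hg : 0 < g) (hL : 0 ≤ L) {x : ℝ} (hx : 0 ≤ Real.cos x) (Y : ℝ) :
    vertSpeed g L x Y ≤ L := by
  refine Real.sqrt_le_iff.2 ⟨hL, ?_⟩
  nlinarith [mul_nonneg hg.le hx, sq_nonneg Y]

theorem vertSpeed_neg (x Y : ℝ) : vertSpeed g L (-x) (-Y) = vertSpeed g L x Y := by
  simp [vertSpeed]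

theorem continuous_vertSpeed :
    Continuous fun p : ℝ × ℝ => vertSpeed g L p.1 p.2 := by
  unfold vertSpeed; fun_prop

/-- The difference of the squares of the two speeds is explicit, and their sum is at least L. -/
theorem abs_vertSpeed_sub_le (hg : 0 < g) (hL : 100 * (1 + g) ≤ L) (x x' : ℝ) {Y Y' : ℝ}
    (hY : |Y| ≤ 1) (hY' : |Y'| ≤ 1) :
    |vertSpeed g L x' Y' - vertSpeed g L x Y| * L ≤ 2 * g * |x' - x| + 2 * |Y' - Y| := by
  have e := vertSpeed_sq hg hL x hY
  have e' := vertSpeed_sq hg hL x' hY'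
  have l := vertSpeed_ge hg hL x hY
  have l' := vertSpeed_ge hg hL x' hY'
  have h1 : (vertSpeed g L x' Y' - vertSpeed g L x Y) * (vertSpeed g L x' Y' + vertSpeed g L x Y)
      = 2 * g * (Real.cos x - Real.cos x') + (Y + Y') * (Y - Y') := by linear_combination e' - e
  have h2 := Real.abs_cos_sub_cos_le x x'
  have h3 : |Y + Y'| ≤ 2 := (abs_add_le _ _).trans (by linarith)
  calc _ ≤ |vertSpeed g L x' Y' - vertSpeed g L x Y|
        * |vertSpeed g L x' Y' + vertSpeed g L x Y| := by
        gcongr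
        exact le_trans (by linarith) (le_abs_self _)
    _ = |2 * g * (Real.cos x - Real.cos x') + (Y + Y') * (Y - Y')| := by rw [← abs_mul, h1]
    _ ≤ 2 * g * |Real.cos x - Real.cos x'| + |Y + Y'| * |Y - Y'| := by
        refine (abs_add_le _ _).trans_eq ?_
        rw [abs_mul, abs_mul (Y + Y'), abs_of_pos (by positivity : 0 < 2 * g)]
    _ ≤ 2 * g * |x' - x| + 2 * |Y' - Y| := by
        rw [abs_sub_comm x' x, abs_sub_comm Y' Y]
        gcongr

theorem flight_neg (x ξ Y : ℝ) : flight g L (-x) (-ξ) (-Y) = -flight g L x ξ Y := by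
  simp only [flight, vertSpeed_neg]; ring

theorem angRefl_neg (x v : ℝ) : angRefl g L (-x) (-v) = -angRefl g L x v := by
  simp only [angRefl, vertSpeed_neg, Real.cos_neg, Real.sin_neg]; ring

theorem angRefl_zero (v : ℝ) : angRefl g L 0 v = v := by
  simp [angRefl]

theorem continuous_angRefl : Continuous fun p : ℝ × ℝ => angRefl g L p.1 p.2 := by
  unfold angRefl
  have := continuous_vertSpeed (g := g) (L := L)
  refine Continuous.div (by fun_prop) (by fun_prop) fun p => by positivity

theorem continuous_flight :
    Continuous fun p : ℝ × ℝ × ℝ => flight g L p.1 p.2.1 p.2.2 := by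
  unfold flight
  have h1 : Continuous fun p : ℝ × ℝ × ℝ => vertSpeed g L p.1 p.2.2 := by
    unfold vertSpeed; fun_prop
  have h2 : Continuous fun p : ℝ × ℝ × ℝ => vertSpeed g L p.2.1 p.2.2 := by
    unfold vertSpeed; fun_prop
  fun_prop

/-- Changing the offset of one end of a flight changes the vertical speed there so little that
the flight distance is affected by at most a fiftieth of the change. -/
theorem abs_mul_vertSpeed_sub_le (hg : 0 < g) (hL : 100 * (1 + g) ≤ L) (x x' : ℝ) {Y : ℝ}
    (hY : |Y| ≤ 1) :
    |Y * (vertSpeed g L x' Y - vertSpeed g L x Y) / g| ≤ |x' - x| / 50 := by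
  have h := abs_vertSpeed_sub_le hg hL x x' hY hY
  have hL0 : 100 ≤ L := by linarith
  rw [abs_div, abs_mul, abs_of_pos hg, div_le_iff₀ hg]
  simp only [sub_self, abs_zero, mul_zero, add_zero] at h
  have h0 := abs_nonneg (vertSpeed g L x' Y - vertSpeed g L x Y)
  nlinarith [mul_le_mul_of_nonneg_right hY h0]

theorem flight_lt_flight_of_lt (hg : 0 < g) (hL : 100 * (1 + g) ≤ L) {x x' : ℝ} (ξ : ℝ) {Y : ℝ}
    (hY : |Y| ≤ 1) (h : x < x') : flight g L x ξ Y < flight g L x' ξ Y := by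
  have h1 := (abs_le.1 (abs_mul_vertSpeed_sub_le hg hL x x' hY)).1
  rw [abs_of_pos (sub_pos.2 h)] at h1
  have : flight g L x' ξ Y - flight g L x ξ Y
      = (x' - x) + Y * (vertSpeed g L x' Y - vertSpeed g L x Y) / g := by
    simp only [flight]; ring
  linarith

theorem flight_le_flight_of_le (hg : 0 < g) (hL : 100 * (1 + g) ≤ L) {x x' : ℝ} (ξ : ℝ) {Y : ℝ}
    (hY : |Y| ≤ 1) (h : x ≤ x') : flight g L x ξ Y ≤ flight g L x' ξ Y := by
  rcases h.eq_or_lt with rfl | h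
  · rfl
  · exact (flight_lt_flight_of_lt hg hL ξ hY h).le

theorem abs_flight_sub_flight_le (hg : 0 < g) (hL : 100 * (1 + g) ≤ L) (x ξ ξ' : ℝ) {Y : ℝ}
    (hY : |Y| ≤ 1) : |flight g L x ξ' Y - flight g L x ξ Y| ≤ 2 * |ξ' - ξ| := by
  have h1 := abs_mul_vertSpeed_sub_le hg hL ξ ξ' hY
  have : flight g L x ξ' Y - flight g L x ξ Y
      = -(ξ' - ξ) + Y * (vertSpeed g L ξ' Y - vertSpeed g L ξ Y) / g := by
    simp only [flight]; ring
  rw [this]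
  refine (abs_add_le _ _).trans ?_
  rw [abs_neg]
  linarith [abs_nonneg (ξ' - ξ)]

theorem flight_antitone_end (hg : 0 < g) (hL : 100 * (1 + g) ≤ L) (x : ℝ) {ξ ξ' Y : ℝ}
    (hY : |Y| ≤ 1) (h : ξ ≤ ξ') : flight g L x ξ' Y ≤ flight g L x ξ Y := by
  have h1 := (abs_le.1 (abs_mul_vertSpeed_sub_le hg hL ξ ξ' hY)).2
  rw [abs_of_nonneg (sub_nonneg.2 h)] at h1
  have : flight g L x ξ' Y - flight g L x ξ Y
      = -(ξ' - ξ) + Y * (vertSpeed g L ξ' Y - vertSpeed g L ξ Y) / g := by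
    simp only [flight]; ring
  linarith

/-- The flight time is of order 2L/g and hardly depends on Y, so the distance grows with Y almost at
that rate. This expansion makes the strips nearly horizontal. -/
theorem mul_sub_le_flight_sub_flight (hg : 0 < g) (hL : 100 * (1 + g) ≤ L) (x ξ : ℝ) {Y Y' : ℝ}
    (hY : |Y| ≤ 1) (hY' : |Y'| ≤ 1) (h : Y ≤ Y') :
    L / g * (Y' - Y) ≤ flight g L x ξ Y' - flight g L x ξ Y := by
  have hL0 : 100 ≤ L := by linarith
  have key : ∀ z, L / 2 * (Y' - Y) ≤ Y' * vertSpeed g L z Y' - Y * vertSpeed g L z Y := by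
    intro z
    have h1 := abs_vertSpeed_sub_le hg hL z z hY hY'
    rw [sub_self, abs_zero, mul_zero, zero_add, abs_of_nonneg (sub_nonneg.2 h)] at h1
    have l := vertSpeed_ge hg hL z hY'
    have h0 := abs_nonneg (vertSpeed g L z Y' - vertSpeed g L z Y)
    have h2 : |Y * (vertSpeed g L z Y' - vertSpeed g L z Y)| ≤ (Y' - Y) / 50 := by
      rw [abs_mul]
      nlinarith [mul_le_mul_of_nonneg_right hY h0]
    have h3 := (abs_le.1 h2).1
    nlinarith [mul_le_mul_of_nonneg_right l (sub_nonneg.2 h)]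
  have e : flight g L x ξ Y' - flight g L x ξ Y
      = ((Y' * vertSpeed g L x Y' - Y * vertSpeed g L x Y)
        + (Y' * vertSpeed g L ξ Y' - Y * vertSpeed g L ξ Y)) / g := by
    simp only [flight]; ring
  rw [e, div_mul_eq_mul_div]
  gcongr
  linarith [key x, key ξ]

theorem angRefl_lt_angRefl_of_lt (hg : 0 < g) (hL : 100 * (1 + g) ≤ L) {x x' v : ℝ}
    (hx : |x| ≤ 1 / 2) (hx' : |x'| ≤ 1 / 2) (hv : |v| ≤ 1) (h : x < x') :
    angRefl g L x v < angRefl g L x' v := by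
  have hL0 : 100 ≤ L := by linarith
  have hs := half_sub_le_sin_sub_sin hx hx' h.le
  have h1 := abs_vertSpeed_sub_le hg hL x x' hv hv
  rw [sub_self, abs_zero, mul_zero, add_zero, abs_of_pos (sub_pos.2 h)] at h1
  have l := vertSpeed_ge hg hL x' hv
  have h0 := abs_nonneg (vertSpeed g L x' v - vertSpeed g L x v)
  have h2 : |vertSpeed g L x' v - vertSpeed g L x v| ≤ (x' - x) / 50 := by
    by_contra! hc
    nlinarith [mul_lt_mul_of_pos_right hc (by linarith : 0 < L), sub_pos.2 h]
  have bs := abs_le.1 (abs_sin_le_half hx)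
  have bs' := abs_le.1 (abs_sin_le_half hx')
  have bv := abs_le.1 hv
  unfold angRefl
  rw [div_lt_div_iff₀ (by positivity) (by positivity), Real.cos_sq', Real.cos_sq']
  set s := Real.sin x
  set s' := Real.sin x'
  set S := vertSpeed g L x v
  set S' := vertSpeed g L x' v
  -- After cross-multiplication the difference is 2(s' - s)((1 - s s')S' - (s + s')v) + 2s(1 +
  -- s'²)(S' - S). The bracket in the first term is at least 1 since S' is of order L; the second
  -- term is at most (x' - x)/25 in size.
  have h3 : |s * (1 + s' ^ 2) * (S' - S)| ≤ (x' - x) / 50 := by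
    rw [abs_mul]
    have : |s * (1 + s' ^ 2)| ≤ 1 := by
      rw [abs_mul, abs_of_pos (by positivity : 0 < 1 + s' ^ 2)]
      have : |s| ≤ 1 / 2 := abs_le.2 bs
      nlinarith [abs_nonneg s]
    nlinarith
  have h4 := (abs_le.1 h3).1
  have h5 : 1 ≤ (1 - s * s') * S' - (s + s') * v := by
    have h6 : 3 / 4 ≤ 1 - s * s' := by nlinarith
    have h7 : (s + s') * v ≤ 1 := by
      have : |(s + s') * v| ≤ 1 * 1 := by
        rw [abs_mul]
        exact mul_le_mul (abs_le.2 ⟨by linarith, by linarith⟩) hv (abs_nonneg _) zero_le_one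
      linarith [le_abs_self ((s + s') * v)]
    nlinarith
  have h8 : (s' - s) * 1 ≤ (s' - s) * ((1 - s * s') * S' - (s + s') * v) :=
    mul_le_mul_of_nonneg_left h5 (by linarith)
  nlinarith

theorem angRefl_lt_angRefl_of_vel_lt (hg : 0 < g) (hL : 100 * (1 + g) ≤ L) {x v v' : ℝ}
    (hx : |x| ≤ 1 / 2) (hv : |v| ≤ 1) (hv' : |v'| ≤ 1) (h : v < v') :
    angRefl g L x v < angRefl g L x v' := by
  have hL0 : 100 ≤ L := by linarith
  have h1 := abs_vertSpeed_sub_le hg hL x x hv hv'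
  rw [sub_self, abs_zero, mul_zero, zero_add, abs_of_pos (sub_pos.2 h)] at h1
  have h2 : |vertSpeed g L x v' - vertSpeed g L x v| ≤ (v' - v) / 50 := by
    by_contra! hc
    nlinarith [mul_lt_mul_of_pos_right hc (by linarith : 0 < L), sub_pos.2 h]
  have bs := abs_sin_le_half hx
  have bs' := abs_le.1 bs
  have h3 : |Real.sin x * (vertSpeed g L x v' - vertSpeed g L x v)| ≤ 1 / 2 * ((v' - v) / 50) := by
    rw [abs_mul]
    gcongr
  have h4 := (abs_le.1 h3).1
  unfold angRefl
  gcongr ?_ / _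
  have h5 : Real.sin x ^ 2 ≤ 1 / 4 := by nlinarith
  rw [Real.cos_sq']
  nlinarith [mul_le_mul_of_nonneg_right h5 (sub_pos.2 h).le]

theorem angRefl_le_angRefl_of_vel_le (hg : 0 < g) (hL : 100 * (1 + g) ≤ L) {x v v' : ℝ}
    (hx : |x| ≤ 1 / 2) (hv : |v| ≤ 1) (hv' : |v'| ≤ 1) (h : v ≤ v') :
    angRefl g L x v ≤ angRefl g L x v' := by
  rcases h.eq_or_lt with rfl | h
  · rfl
  · exact (angRefl_lt_angRefl_of_vel_lt hg hL hx hv hv' h).le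

theorem abs_angRefl_le (hg : 0 < g) (hL : 0 ≤ L) {x v : ℝ} (hx : |x| ≤ 1 / 2) :
    |angRefl g L x v| ≤ |v| + 2 * |x| * L := by
  have hc := cos_ge_of_abs_le_half hx
  have h1 := vertSpeed_le hg hL (by linarith) v (x := x)
  have h0 : 0 ≤ vertSpeed g L x v := Real.sqrt_nonneg _
  have hs : |Real.sin x| ≤ |x| := Real.abs_sin_le_abs
  unfold angRefl
  rw [abs_div, abs_of_pos (by positivity : 0 < 1 + Real.sin x ^ 2), div_le_iff₀ (by positivity)]
  have h2 : |Real.cos x ^ 2 * v + 2 * Real.sin x * vertSpeed g L x v| ≤ |v| + 2 * |x| * L := by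
    refine (abs_add_le _ _).trans ?_
    rw [abs_mul, abs_mul, abs_mul, abs_of_nonneg h0, abs_of_nonneg (sq_nonneg (Real.cos x)),
      abs_two]
    gcongr
    nlinarith [Real.cos_sq_le_one x, abs_nonneg v]
  refine h2.trans (le_mul_of_one_le_right (by positivity) ?_)
  nlinarith [sq_nonneg (Real.sin x)]

theorem angRefl_sq_add_vertRefl_sq (hg : 0 < g) (hL : 100 * (1 + g) ≤ L) {x v : ℝ}
    (hv : |v| ≤ 1) :
    angRefl g L x v ^ 2 + vertRefl g L x v ^ 2 = L ^ 2 - 2 * g * Real.cos x := by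
  have e := vertSpeed_sq hg hL x hv
  have : angRefl g L x v ^ 2 + vertRefl g L x v ^ 2 = v ^ 2 + vertSpeed g L x v ^ 2 := by
    unfold angRefl vertRefl
    rw [Real.cos_sq']
    field_simp
    ring
  linarith

theorem vertRefl_pos (hg : 0 < g) (hL : 100 * (1 + g) ≤ L) {x v : ℝ}
    (hx : |x| ≤ 1 / 2) (hv : |v| ≤ 1) : 0 < vertRefl g L x v := by
  have bs := abs_sin_le_half hx
  have bs' := abs_le.1 bs
  have l := vertSpeed_ge hg hL x hv
  have h : |Real.sin x * v| ≤ 1 / 2 * 1 := by rw [abs_mul]; gcongr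
  have h' := (abs_le.1 h).2
  unfold vertRefl
  refine div_pos ?_ (by positivity)
  have h5 : Real.sin x ^ 2 ≤ 1 / 4 := by nlinarith
  rw [Real.cos_sq']
  nlinarith

/-- Reflection preserves energy and the outgoing vertical velocity is positive. Thus the whole
flight is determined by x and the outgoing angular velocity, without v. -/
theorem vertRefl_eq (hg : 0 < g) (hL : 100 * (1 + g) ≤ L) {x v : ℝ}
    (hx : |x| ≤ 1 / 2) (hv : |v| ≤ 1) :
    vertRefl g L x v = vertSpeed g L x (angRefl g L x v) := by
  have h := angRefl_sq_add_vertRefl_sq hg hL hv (x := x)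
  rw [vertSpeed, ← h, add_sub_cancel_left, Real.sqrt_sq (vertRefl_pos hg hL hx hv).le]

end Speed

open Set

/-! ### Horizontal strips from the images of the top and bottom sides. -/

/-- The part in `[-ε, ε] × [-w, w]` of the image of `[-ε, ε] × [-w, w]` under the return map, both
rectangles being centred at maxima of `|sin|`, the second one at distance `c` from the first. -/
def imagePart (g L ε w c : ℝ) : Set (ℝ × ℝ) :=
  {p | p.1 ∈ Icc (-ε) ε ∧ p.2 ∈ Icc (-w) w ∧ ∃ x ∈ Icc (-ε) ε, ∃ v ∈ Icc (-w) w,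
    p.2 = angRefl g L x v ∧ flight g L x p.1 p.2 = c}

theorem continuous_angRefl_vel (g L x : ℝ) : Continuous (angRefl g L x) := by
  have := continuous_angRefl (g := g) (L := L)
  exact this.comp (f := fun v : ℝ => (x, v)) (by fun_prop)

theorem continuous_angRefl_pos (g L v : ℝ) : Continuous fun x => angRefl g L x v := by
  have := continuous_angRefl (g := g) (L := L)
  exact this.comp (f := fun x : ℝ => (x, v)) (by fun_prop)

theorem continuous_flight_pos (g L ξ Y : ℝ) : Continuous fun x => flight g L x ξ Y := by
  have := continuous_flight (g := g) (L := L)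
  exact this.comp (f := fun x : ℝ => (x, ξ, Y)) (by fun_prop)

theorem continuous_flight_angRefl (g L ξ v : ℝ) :
    Continuous fun x => flight g L x ξ (angRefl g L x v) := by
  have h := continuous_flight (g := g) (L := L)
  have h' := continuous_angRefl_pos g L v
  exact h.comp (f := fun x : ℝ => (x, ξ, angRefl g L x v)) (by fun_prop)

/-- If the images of the top and of the bottom side of a rectangle cross another rectangle
horizontally, then the image of the rectangle meets the other one in a horizontal strip. -/
theorem isHorizontalStrip_imagePart {g L ε w c : ℝ} (hg : 0 < g) (hL : 100 * (1 + g) ≤ L)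
    (hε : 0 < ε) (hε1 : ε ≤ 1 / 2) (hw : 0 < w) (hw1 : w ≤ 1)
    (hU : ∀ x ∈ Icc (-ε) ε, ∀ v ∈ Icc (-w) w, |angRefl g L x v| ≤ 1)
    (htopl : ∀ ξ ∈ Icc (-ε) ε, flight g L (-ε) ξ (angRefl g L (-ε) w) ≤ c)
    (htopr : ∀ ξ ∈ Icc (-ε) ε, c ≤ flight g L 0 ξ w)
    (hbotl : ∀ ξ ∈ Icc (-ε) ε, flight g L 0 ξ (-w) ≤ c)
    (hbotr : ∀ ξ ∈ Icc (-ε) ε, c ≤ flight g L ε ξ (angRefl g L ε (-w))) :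
    IsHorizontalStrip (2 * g / L) (-ε) ε (-w) w (imagePart g L ε w c) := by
  have hL0 : 0 < L := by linarith
  have hwm : w ∈ Icc (-w) w := ⟨by linarith, le_rfl⟩
  have hwm' : -w ∈ Icc (-w) w := ⟨le_rfl, by linarith⟩
  have absx : ∀ x ∈ Icc (-ε) ε, |x| ≤ 1 / 2 := fun x hx => (abs_le.2 hx).trans hε1
  have absv : ∀ v ∈ Icc (-w) w, |v| ≤ 1 := fun v hv => (abs_le.2 hv).trans hw1
  have cont := continuous_flight_angRefl g L
  have flt : ∀ x ∈ Icc (-ε) ε, ∀ x' ∈ Icc (-ε) ε, ∀ ξ Y Y', |Y| ≤ 1 → |Y'| ≤ 1 → x ≤ x' →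
      Y < Y' → flight g L x ξ Y < flight g L x' ξ Y' := by
    intro x _ x' _ ξ Y Y' hY hY' hx h
    have h1 := mul_sub_le_flight_sub_flight hg hL x' ξ hY hY' h.le
    have h2 := flight_le_flight_of_le hg hL ξ hY hx
    have : 0 < L / g * (Y' - Y) := mul_pos (by positivity) (by linarith)
    linarith
  have Ux : ∀ v ∈ Icc (-w) w, ∀ x ∈ Icc (-ε) ε, ∀ x' ∈ Icc (-ε) ε, x ≤ x' →
      angRefl g L x v ≤ angRefl g L x' v := by
    intro v hv x hx x' hx' h
    rcases h.eq_or_lt with rfl | h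
    · rfl
    · exact (angRefl_lt_angRefl_of_lt hg hL (absx x hx) (absx x' hx') (absv v hv) h).le
  -- Only the left half of the top side and the right half of the bottom side are needed: at x = 0
  -- reflection does not change v, so the velocities there stay within [-w, w]. The value 0 for
  -- other ξ is a dummy that lets `choose` give total functions.
  have top : ∀ ξ, ∃ x, ξ ∈ Icc (-ε) ε →
      x ∈ Icc (-ε) 0 ∧ flight g L x ξ (angRefl g L x w) = c := by
    intro ξ
    by_cases hξ : ξ ∈ Icc (-ε) ε
    · obtain ⟨x, hx, e⟩ := intermediate_value_Icc (by linarith : -ε ≤ 0) (cont ξ w).continuousOn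
        ⟨htopl ξ hξ, by rw [angRefl_zero]; exact htopr ξ hξ⟩
      exact ⟨x, fun _ => ⟨hx, e⟩⟩
    · exact ⟨0, fun h => absurd h hξ⟩
  have bot : ∀ ξ, ∃ x, ξ ∈ Icc (-ε) ε →
      x ∈ Icc 0 ε ∧ flight g L x ξ (angRefl g L x (-w)) = c := by
    intro ξ
    by_cases hξ : ξ ∈ Icc (-ε) ε
    · obtain ⟨x, hx, e⟩ := intermediate_value_Icc hε.le (cont ξ (-w)).continuousOn
        ⟨by rw [angRefl_zero]; exact hbotl ξ hξ, hbotr ξ hξ⟩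
      exact ⟨x, fun _ => ⟨hx, e⟩⟩
    · exact ⟨0, fun h => absurd h hξ⟩
  choose x₂ hx₂ using top
  choose x₁ hx₁ using bot
  have m₂ : ∀ ξ ∈ Icc (-ε) ε, x₂ ξ ∈ Icc (-ε) ε := fun ξ hξ =>
    ⟨(hx₂ ξ hξ).1.1, (hx₂ ξ hξ).1.2.trans hε.le⟩
  have m₁ : ∀ ξ ∈ Icc (-ε) ε, x₁ ξ ∈ Icc (-ε) ε := fun ξ hξ =>
    ⟨(by linarith : -ε ≤ 0).trans (hx₁ ξ hξ).1.1, (hx₁ ξ hξ).1.2⟩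
  have zm : (0 : ℝ) ∈ Icc (-ε) ε := ⟨by linarith, hε.le⟩
  -- If the lower curve were not below the upper one, monotonicity of `angRefl` would force x₂ < x₁,
  -- and then the flight from x₁ would be strictly longer than that from x₂, although both equal c.
  have lt : ∀ ξ ∈ Icc (-ε) ε,
      angRefl g L (x₁ ξ) (-w) < angRefl g L (x₂ ξ) w := by
    intro ξ hξ
    have h1 := angRefl_lt_angRefl_of_vel_lt hg hL (absx _ (m₁ ξ hξ)) (absv _ hwm') (absv _ hwm)
      (by linarith)
    by_contra! hc
    have hlt : x₂ ξ < x₁ ξ := by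
      by_contra! h
      have := Ux w hwm _ (m₁ ξ hξ) _ (m₂ ξ hξ) h
      linarith
    have h2 := flight_lt_flight_of_lt hg hL ξ (hU _ (m₂ ξ hξ) _ hwm) hlt
    rcases hc.eq_or_lt with hc | hc
    · rw [hc] at h2
      linarith [(hx₁ ξ hξ).2, (hx₂ ξ hξ).2, hc ▸ (hx₂ ξ hξ).2]
    · have := flt _ (m₂ ξ hξ) _ (m₁ ξ hξ) ξ _ _ (hU _ (m₂ ξ hξ) _ hwm) (hU _ (m₁ ξ hξ) _ hwm')
        hlt.le hc
      linarith [(hx₁ ξ hξ).2, (hx₂ ξ hξ).2]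
  have low : ∀ ξ ∈ Icc (-ε) ε, -w ≤ angRefl g L (x₁ ξ) (-w) := fun ξ hξ => by
    simpa only [angRefl_zero] using Ux (-w) hwm' 0 zm _ (m₁ ξ hξ) (hx₁ ξ hξ).1.1
  have high : ∀ ξ ∈ Icc (-ε) ε, angRefl g L (x₂ ξ) w ≤ w := fun ξ hξ => by
    simpa only [angRefl_zero] using Ux w hwm _ (m₂ ξ hξ) 0 zm (hx₂ ξ hξ).1.2
  -- Along a side, x and Y increase together, so their contributions to the flight add up. The
  -- contribution of Y, at least (L/g)|ΔY|, must then be compensated by that of ξ, which is at most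
  -- 2|Δξ|.
  have lip : ∀ v ∈ Icc (-w) w, ∀ y : ℝ → ℝ, (∀ ξ ∈ Icc (-ε) ε, y ξ ∈ Icc (-ε) ε) →
      (∀ ξ ∈ Icc (-ε) ε, flight g L (y ξ) ξ (angRefl g L (y ξ) v) = c) →
      ∀ ξ ∈ Icc (-ε) ε, ∀ ξ' ∈ Icc (-ε) ε,
        |angRefl g L (y ξ) v - angRefl g L (y ξ') v| ≤ 2 * g / L * |ξ - ξ'| := by
    intro v hv y hy hc
    have key : ∀ ξ ∈ Icc (-ε) ε, ∀ ξ' ∈ Icc (-ε) ε, angRefl g L (y ξ) v ≤ angRefl g L (y ξ') v →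
        |angRefl g L (y ξ) v - angRefl g L (y ξ') v| ≤ 2 * g / L * |ξ - ξ'| := by
      intro ξ hξ ξ' hξ' h
      have h1 := mul_sub_le_flight_sub_flight hg hL (y ξ) ξ' (hU _ (hy ξ hξ) v hv)
        (hU _ (hy ξ' hξ') v hv) h
      have h2 := (abs_le.1 (abs_flight_sub_flight_le hg hL (y ξ) ξ ξ' (hU _ (hy ξ hξ) v hv))).1
      have hle : y ξ ≤ y ξ' := by
        by_contra! hlt
        exact absurd (angRefl_lt_angRefl_of_lt hg hL (absx _ (hy ξ' hξ')) (absx _ (hy ξ hξ))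
          (absv v hv) hlt) h.not_gt
      have h3 := flight_le_flight_of_le hg hL ξ' (hU _ (hy ξ' hξ') v hv) hle
      rw [hc ξ' hξ'] at h3
      rw [hc ξ hξ] at h2
      rw [abs_sub_comm, abs_of_nonneg (sub_nonneg.2 h), abs_sub_comm ξ]
      have h4 : L / g * (angRefl g L (y ξ') v - angRefl g L (y ξ) v) ≤ 2 * |ξ' - ξ| := by linarith
      rw [div_mul_eq_mul_div, div_le_iff₀ hg] at h4
      rw [div_mul_eq_mul_div, le_div_iff₀ hL0]
      linarith
    intro ξ hξ ξ' hξ'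
    rcases le_total (angRefl g L (y ξ) v) (angRefl g L (y ξ') v) with h | h
    · exact key ξ hξ ξ' hξ' h
    · rw [abs_sub_comm, abs_sub_comm ξ]
      exact key ξ' hξ' ξ hξ h
  refine ⟨fun ξ => angRefl g L (x₁ ξ) (-w), fun ξ => angRefl g L (x₂ ξ) w,
    ⟨fun ξ hξ => ⟨low ξ hξ, (lt ξ hξ).le.trans (high ξ hξ)⟩,
      lip _ hwm' _ m₁ fun ξ hξ => (hx₁ ξ hξ).2⟩,
    ⟨fun ξ hξ => ⟨(low ξ hξ).trans (lt ξ hξ).le, high ξ hξ⟩,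
      lip _ hwm _ m₂ fun ξ hξ => (hx₂ ξ hξ).2⟩, lt, ?_⟩
  ext ⟨ξ, Y⟩
  simp only [imagePart, mem_ofPred_eq]
  refine and_congr_right fun hξ => ⟨?_, ?_⟩
  · rintro ⟨-, x, hx, v, hv, hY, hG⟩
    have b := hU x hx v hv
    rw [← hY] at b
    constructor
    · by_contra! h
      have h1 : x₁ ξ < x := by
        by_contra! hle
        have := flt _ hx _ (m₁ ξ hξ) ξ _ _ b (hU _ (m₁ ξ hξ) _ hwm') hle h
        linarith [(hx₁ ξ hξ).2]
      have h2 := Ux _ hwm' _ (m₁ ξ hξ) _ hx h1.le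
      have h3 := angRefl_le_angRefl_of_vel_le hg hL (absx x hx) (absv _ hwm') (absv v hv) hv.1
      linarith
    · by_contra! h
      have h1 : x < x₂ ξ := by
        by_contra! hle
        have := flt _ (m₂ ξ hξ) _ hx ξ _ _ (hU _ (m₂ ξ hξ) _ hwm) b hle h
        linarith [(hx₂ ξ hξ).2]
      have h2 := Ux _ hwm _ hx _ (m₂ ξ hξ) h1.le
      have h3 := angRefl_le_angRefl_of_vel_le hg hL (absx x hx) (absv v hv) (absv _ hwm) hv.2
      linarith
  · rintro ⟨hY1, hY2⟩
    have hYw : Y ∈ Icc (-w) w := ⟨(low ξ hξ).trans hY1, hY2.trans (high ξ hξ)⟩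
    have bY := absv Y hYw
    have b₁ := hU _ (m₁ ξ hξ) _ hwm'
    have b₂ := hU _ (m₂ ξ hξ) _ hwm
    have fY : ∀ x, ∀ Y Y', |Y| ≤ 1 → |Y'| ≤ 1 → Y ≤ Y' →
        flight g L x ξ Y ≤ flight g L x ξ Y' := fun x Y Y' h1 h2 h => by
      have := mul_sub_le_flight_sub_flight hg hL x ξ h1 h2 h
      have h0 : 0 ≤ L / g * (Y' - Y) := mul_nonneg (by positivity) (by linarith)
      linarith
    have c₂ : flight g L (x₂ ξ) ξ Y ≤ c := (fY (x₂ ξ) _ _ bY b₂ hY2).trans_eq (hx₂ ξ hξ).2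
    have c₁ : c ≤ flight g L (x₁ ξ) ξ Y := (hx₁ ξ hξ).2.symm.trans_le (fY (x₁ ξ) _ _ b₁ bY hY1)
    -- With ξ and Y fixed, first solve the flight equation for x between x₂ ξ and x₁ ξ, then solve
    -- for v at this x. Monotonicity of `angRefl` in x places Y between its values at v = -w and v =
    -- w.
    obtain ⟨x, hx, hG⟩ := intermediate_value_Icc
      ((hx₂ ξ hξ).1.2.trans (hx₁ ξ hξ).1.1) (continuous_flight_pos g L ξ Y).continuousOn ⟨c₂, c₁⟩
    have hxm : x ∈ Icc (-ε) ε := ⟨(m₂ ξ hξ).1.trans hx.1, hx.2.trans (m₁ ξ hξ).2⟩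
    have v₁ : angRefl g L x (-w) ≤ Y := (Ux _ hwm' _ hxm _ (m₁ ξ hξ) hx.2).trans hY1
    have v₂ : Y ≤ angRefl g L x w := hY2.trans (Ux _ hwm _ (m₂ ξ hξ) _ hxm hx.1)
    obtain ⟨v, hv, hvY⟩ := intermediate_value_Icc (by linarith : -w ≤ w)
      (continuous_angRefl_vel g L x).continuousOn
      ⟨v₁, v₂⟩
    exact ⟨hYw, x, hxm, v, hv, hvY.symm, hG⟩

/-! ### Consequences of the corner condition. -/

section Corner

variable {g L ε w : ℝ}

/-- For w = εL the leading terms -w + 2εL add up to exactly w. The loss εg/L comes from the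
potential energy, which makes the vertical speed smaller than L; `pi_add_le_of_corner` depends on
this loss. -/
theorem angRefl_corner_le (hg : 0 < g) (hL : 100 * (1 + g) ≤ L) (hε : 0 < ε) (hε1 : ε ≤ 1 / 2)
    (hw : w = ε * L) : angRefl g L ε (-w) ≤ w - ε * g / L := by
  have hL0 : 0 < L := by linarith
  have ha : |ε| ≤ 1 / 2 := by rwa [abs_of_pos hε]
  have hc := cos_ge_of_abs_le_half ha
  have bs := abs_le.1 (abs_sin_le_half ha)
  have hs := Real.sin_le hε.le
  have hP : vertSpeed g L ε (-w) ≤ L - g * Real.cos ε / L := by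
    have h1 : g * Real.cos ε ≤ L * L := by nlinarith [Real.cos_le_one ε]
    refine Real.sqrt_le_iff.2 ⟨by rw [sub_nonneg, div_le_iff₀ hL0]; exact h1, ?_⟩
    have : (L - g * Real.cos ε / L) ^ 2
        = L ^ 2 - 2 * g * Real.cos ε + (g * Real.cos ε / L) ^ 2 := by field_simp; ring
    rw [this]
    nlinarith [sq_nonneg w, sq_nonneg (g * Real.cos ε / L)]
  have h0 : 0 ≤ vertSpeed g L ε (-w) := Real.sqrt_nonneg _
  have h1 : Real.sin ε * vertSpeed g L ε (-w) ≤ ε * (L - g * Real.cos ε / L) :=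
    mul_le_mul hs hP h0 hε.le
  unfold angRefl
  rw [div_le_iff₀ (by positivity), Real.cos_sq']
  have h2 : ε * (L - g * Real.cos ε / L) = w - ε * g / L * Real.cos ε := by rw [hw]; ring
  have h3 : 0 < ε * g / L := by positivity
  have h4 := mul_le_mul_of_nonneg_left hc h3.le
  have h5 : Real.sin ε ^ 2 ≤ 1 / 4 := by nlinarith
  have h6 := mul_le_mul_of_nonneg_left h5 h3.le
  linarith

theorem le_angRefl_corner (hg : 0 < g) (hL : 100 * (1 + g) ≤ L) (hε : 0 < ε) (hε1 : ε ≤ 1 / 50)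
    (hw : w = ε * L) (hw1 : w ≤ 1) : 4 / 5 * w ≤ angRefl g L ε (-w) := by
  have hL0 : 0 < L := by linarith
  have hw0 : 0 < w := by rw [hw]; positivity
  have hs := Real.sin_le hε.le
  have hs' : 99 / 100 * ε ≤ Real.sin ε := by
    have := Real.sin_gt_sub_cube hε
    nlinarith [mul_pos hε hε]
  have l := vertSpeed_ge hg hL ε (Y := -w) (by rw [abs_neg, abs_of_pos hw0]; exact hw1)
  unfold angRefl
  rw [le_div_iff₀ (by positivity), Real.cos_sq']
  have h1 : 99 / 100 * ε * (19 / 20 * L) ≤ Real.sin ε * vertSpeed g L ε (-w) :=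
    mul_le_mul hs' l (by positivity) (by linarith)
  have h2 : Real.sin ε ^ 2 ≤ 1 / 2500 := by nlinarith
  have h3 : w * Real.sin ε ^ 2 ≤ w * (1 / 2500) := mul_le_mul_of_nonneg_left h2 hw0.le
  have h4 : 0 ≤ w * Real.sin ε ^ 2 := by positivity
  have h5 : 99 / 100 * ε * (19 / 20 * L) = 99 / 100 * (19 / 20) * w := by rw [hw]; ring
  nlinarith

/-- By symmetry the corner condition can be read at (ε, -w), whose outgoing angular velocity m is
positive. Equal offsets at both ends cancel, and the condition becomes 2mS(ε, m) = gπ. -/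
theorem flight_corner (g L ε w : ℝ) :
    flight g L (-ε) (-ε) (angRefl g L (-ε) w)
      = -(2 * angRefl g L ε (-w) * vertSpeed g L ε (angRefl g L ε (-w)) / g) := by
  have h : angRefl g L (-ε) w = -angRefl g L ε (-w) := by
    simpa using angRefl_neg (g := g) (L := L) ε (-w)
  rw [h, flight_neg]
  simp only [flight]; ring

theorem mul_vertSpeed_corner_le (hg : 0 < g) (hL : 100 * (1 + g) ≤ L) (hε : 0 < ε)
    (hε1 : ε ≤ 1 / 50) (hw : w = ε * L) :
    angRefl g L ε (-w) * vertSpeed g L ε (angRefl g L ε (-w)) ≤ w * L := by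
  have hL0 : 0 < L := by linarith
  have hw0 : 0 < w := by rw [hw]; positivity
  have h1 := angRefl_corner_le hg hL hε (by linarith) hw
  have h3 : 0 < ε * g / L := by positivity
  have hc := cos_ge_of_abs_le_half (x := ε) (by rw [abs_of_pos hε]; linarith)
  exact mul_le_mul (by linarith) (vertSpeed_le hg hL0.le (by linarith) _) (Real.sqrt_nonneg _)
    hw0.le

theorem le_mul_vertSpeed_corner (hg : 0 < g) (hL : 100 * (1 + g) ≤ L) (hε : 0 < ε)
    (hε1 : ε ≤ 1 / 50) (hw : w = ε * L) (hw1 : w ≤ 1) :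
    3 / 4 * (w * L) ≤ angRefl g L ε (-w) * vertSpeed g L ε (angRefl g L ε (-w)) := by
  have hL0 : 0 < L := by linarith
  have hw0 : 0 < w := by rw [hw]; positivity
  have h1 := angRefl_corner_le hg hL hε (by linarith) hw
  have h2 := le_angRefl_corner hg hL hε hε1 hw hw1
  have h3 : 0 < ε * g / L := by positivity
  have l := vertSpeed_ge hg hL ε (Y := angRefl g L ε (-w)) (abs_le.2 ⟨by linarith, by linarith⟩)
  have := mul_le_mul h2 l (by positivity) (by linarith)
  nlinarith [mul_pos hw0 hL0]

/-- If the corner `(-ε, w)` of the rectangle is mapped to the left side of the rectangle at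
distance `-π`, then a point leaving the middle of the bottom side flies beyond that side. -/
theorem pi_add_le_of_corner (hg : 0 < g) (hL : 100 * (1 + g) ≤ L) (hε : 0 < ε)
    (hε1 : ε ≤ 1 / 50) (hw : w = ε * L) (hw1 : w ≤ 1)
    (hc : flight g L (-ε) (-ε) (angRefl g L (-ε) w) = -Real.pi) :
    g * (Real.pi + ε) ≤ 2 * w * vertSpeed g L 0 w := by
  have hL0 : 0 < L := by linarith
  have hw0 : 0 < w := by rw [hw]; positivity
  have h1 := angRefl_corner_le hg hL hε (by linarith) hw
  have h2 := le_angRefl_corner hg hL hε hε1 hw hw1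
  have h3 : 0 < ε * g / L := by positivity
  rw [flight_corner, neg_inj, div_eq_iff hg.ne'] at hc
  set m := angRefl g L ε (-w)
  have bm : |m| ≤ 1 := abs_le.2 ⟨by linarith, by linarith⟩
  have bw : |w| ≤ 1 := abs_le.2 ⟨by linarith, by linarith⟩
  have l := vertSpeed_ge hg hL ε bm
  have l0 := vertSpeed_ge hg hL 0 bw
  have e := vertSpeed_sq hg hL ε bm
  have e0 := vertSpeed_sq hg hL 0 bw
  rw [Real.cos_zero] at e0
  have hcos := Real.one_sub_sq_div_two_le_cos (x := ε)
  set S := vertSpeed g L ε m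
  set S₀ := vertSpeed g L 0 w
  have hd : 0 ≤ w - m := by linarith
  have h4 : (S - S₀) * (S + S₀) ≤ g * ε ^ 2 + 2 * w * (w - m) := by
    have h : (S - S₀) * (S + S₀) = 2 * g * (1 - Real.cos ε) + (w - m) * (w + m) := by
      linear_combination e - e0
    have h' : (w - m) * (w + m) ≤ (w - m) * (2 * w) := mul_le_mul_of_nonneg_left (by linarith) hd
    have h'' := mul_le_mul_of_nonneg_left hcos hg.le
    linarith
  have h5 : (S - S₀) * L ≤ g * ε ^ 2 + 2 * w * (w - m) := by
    rcases le_total S S₀ with h | h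
    · exact (mul_nonpos_of_nonpos_of_nonneg (by linarith) hL0.le).trans (by positivity)
    · exact (mul_le_mul_of_nonneg_left (by linarith) (by linarith)).trans h4
  have h6 : (S - S₀) * w ≤ ε * (g * ε ^ 2 + 2 * w * (w - m)) := by
    have : (S - S₀) * w = ε * ((S - S₀) * L) := by rw [hw]; ring
    rw [this]
    exact mul_le_mul_of_nonneg_left h5 hε.le
  have h7 : ε * g ≤ (w - m) * L := by
    rw [← div_le_iff₀ hL0]; linarith
  have h8 : (w - m) * (19 / 20 * L) ≤ (w - m) * S := mul_le_mul_of_nonneg_left l hd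
  have h9 : ε * w * (w - m) ≤ 1 / 50 * ((w - m) * L) := by
    have h : ε * w ≤ 1 / 50 * L := mul_le_mul hε1 (by linarith) hw0.le (by norm_num)
    linarith [mul_le_mul_of_nonneg_right h hd]
  have h10 : g * ε ^ 3 ≤ 1 / 50 * (ε * g) := by
    have : ε ^ 2 ≤ 1 / 50 := by nlinarith
    linarith [mul_le_mul_of_nonneg_left this (by positivity : 0 ≤ ε * g)]
  -- The excess of 2wS₀ over 2mS = gπ is 2(w - m)S - 2(S - S₀)w. Its first term is at least
  -- (19/10)(w - m)L, where (w - m)L ≥ εg, and the subtracted term is at most a small fraction of (w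
  -- - m)L. This leaves more than the required gε.
  have h11 : 2 * w * S₀ = 2 * m * S + 2 * ((w - m) * S) - 2 * ((S - S₀) * w) := by ring
  have h12 : ε * (g * ε ^ 2 + 2 * w * (w - m)) = g * ε ^ 3 + 2 * (ε * w * (w - m)) := by ring
  rw [h11, hc]
  rw [h12] at h6
  linarith [mul_pos hε hg]

/-- Away from a maximum the boundary is lower and the landing speed larger, so the symmetric flight
time 2S(0, w)/g of `pi_add_le_of_corner` is a lower bound. -/
theorem flight_zero_le_of_corner (hg : 0 < g) (hL : 100 * (1 + g) ≤ L) (hε : 0 < ε)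
    (hε1 : ε ≤ 1 / 50) (hw : w = ε * L) (hw1 : w ≤ 1)
    (hc : flight g L (-ε) (-ε) (angRefl g L (-ε) w) = -Real.pi) {ξ : ℝ} (hξ : ξ ∈ Icc (-ε) ε) :
    flight g L 0 ξ (-w) ≤ -Real.pi := by
  have hw0 : 0 < w := by rw [hw]; nlinarith
  have h := pi_add_le_of_corner hg hL hε hε1 hw hw1 hc
  have h1 : vertSpeed g L 0 w ≤ vertSpeed g L ξ w := by
    refine Real.sqrt_le_sqrt ?_
    rw [Real.cos_zero]
    nlinarith [Real.cos_le_one ξ]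
  have h2 : flight g L 0 ξ (-w)
      = -ξ - w * (vertSpeed g L 0 w + vertSpeed g L ξ w) / g := by
    simp only [flight, vertSpeed, neg_sq]; ring
  have h3 : Real.pi + ε ≤ w * (vertSpeed g L 0 w + vertSpeed g L ξ w) / g := by
    rw [le_div_iff₀ hg]
    nlinarith
  rw [h2]
  linarith [hξ.1]

theorem abs_angRefl_le_one (hg : 0 < g) (hL : 100 * (1 + g) ≤ L) (hε1 : ε ≤ 1 / 50)
    (hw : w = ε * L) (hw1 : w ≤ 1 / 50) {x v : ℝ} (hx : x ∈ Icc (-ε) ε) (hv : v ∈ Icc (-w) w) :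
    |angRefl g L x v| ≤ 1 := by
  have hL0 : 0 < L := by linarith
  have hx' := abs_le.2 hx
  have := abs_angRefl_le hg hL0.le (x := x) (v := v) (by linarith)
  have hv' := abs_le.2 hv
  nlinarith

theorem isHorizontalStrip_of_corner (hg : 0 < g) (hL : 100 * (1 + g) ≤ L) (hε : 0 < ε)
    (hε1 : ε ≤ 1 / 50) (hw : w = ε * L) (hw1 : w ≤ 1 / 50)
    (hc : flight g L (-ε) (-ε) (angRefl g L (-ε) w) = -Real.pi) {c : ℝ} (hcπ : |c| ≤ Real.pi) :
    IsHorizontalStrip (2 * g / L) (-ε) ε (-w) w (imagePart g L ε w c) := by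
  have hw0 : 0 < w := by rw [hw]; nlinarith
  have hcp := abs_le.1 hcπ
  have hU : ∀ x ∈ Icc (-ε) ε, ∀ v ∈ Icc (-w) w, |angRefl g L x v| ≤ 1 :=
    fun x hx v hv => abs_angRefl_le_one hg hL hε1 hw hw1 hx hv
  have mε : -ε ∈ Icc (-ε) ε := ⟨le_rfl, by linarith⟩
  have mw : w ∈ Icc (-w) w := ⟨by linarith, le_rfl⟩
  have top : ∀ ξ ∈ Icc (-ε) ε, flight g L (-ε) ξ (angRefl g L (-ε) w) ≤ -Real.pi := fun ξ hξ =>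
    (flight_antitone_end hg hL _ (hU _ mε _ mw) hξ.1).trans_eq hc
  have bot : ∀ ξ ∈ Icc (-ε) ε, flight g L 0 ξ (-w) ≤ -Real.pi := fun ξ hξ =>
    flight_zero_le_of_corner hg hL hε hε1 hw (by linarith) hc hξ
  have neg : ∀ ξ ∈ Icc (-ε) ε, -ξ ∈ Icc (-ε) ε := fun ξ hξ =>
    ⟨by linarith [hξ.2], by linarith [hξ.1]⟩
  refine isHorizontalStrip_imagePart hg hL hε (by linarith) hw0 (by linarith) hU
    (fun ξ hξ => (top ξ hξ).trans hcp.1) (fun ξ hξ => ?_) (fun ξ hξ => (bot ξ hξ).trans hcp.1)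
    (fun ξ hξ => ?_)
  -- The two conditions on the right are the reflections of those on the left under (x, ξ, v) ↦ (-x,
  -- -ξ, -v).
  · have h := bot _ (neg ξ hξ)
    have h' := flight_neg (g := g) (L := L) 0 ξ w
    rw [neg_zero] at h'
    linarith
  · have h := top _ (neg ξ hξ)
    have h' := flight_neg (g := g) (L := L) ε ξ (angRefl g L ε (-w))
    have h'' := angRefl_neg (g := g) (L := L) ε (-w)
    rw [neg_neg] at h''
    rw [h'', h'] at h
    linarith

/-- At a common point (ξ, Y) the two flights differ only in their starting offsets, so their lengths
differ by little more than 2ε. -/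
theorem disjoint_imagePart (hg : 0 < g) (hL : 100 * (1 + g) ≤ L)
    (hε1 : ε ≤ 1 / 50) (hw1 : w ≤ 1 / 50) {c c' : ℝ} (h : 1 < |c - c'|) :
    Disjoint (imagePart g L ε w c) (imagePart g L ε w c') := by
  rw [Set.disjoint_left]
  rintro ⟨ξ, Y⟩ ⟨hξ, hY, x, hx, -, -, -, e⟩ ⟨-, -, x', hx', -, -, -, e'⟩
  have hY1 : |Y| ≤ 1 := (abs_le.2 hY).trans (by linarith)
  have h1 := abs_mul_vertSpeed_sub_le hg hL x' x hY1
  have h2 : c - c' = (x - x') + Y * (vertSpeed g L x Y - vertSpeed g L x' Y) / g := by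
    rw [← e, ← e']; simp only [flight]; ring
  have h3 := abs_add_le (x - x') (Y * (vertSpeed g L x Y - vertSpeed g L x' Y) / g)
  rw [← h2] at h3
  have h4 : |x - x'| ≤ 2 * ε := abs_le.2 ⟨by linarith [hx.1, hx'.2], by linarith [hx.2, hx'.1]⟩
  linarith

/-- The corner condition gives (3/4)wL ≤ gπ/2, so the term with Y is at most 2wL/g ≤ 4π/3; the
offsets add at most 2ε. -/
theorem abs_flight_lt_two_pi (hg : 0 < g) (hL : 100 * (1 + g) ≤ L) (hε : 0 < ε)
    (hε1 : ε ≤ 1 / 50) (hw : w = ε * L) (hw1 : w ≤ 1 / 50)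
    (hc : flight g L (-ε) (-ε) (angRefl g L (-ε) w) = -Real.pi) {x ξ Y : ℝ}
    (hx : x ∈ Icc (-ε) ε) (hξ : ξ ∈ Icc (-ε) ε) (hY : Y ∈ Icc (-w) w) :
    |flight g L x ξ Y| < 2 * Real.pi := by
  have hL0 : 0 < L := by linarith
  have h1 := le_mul_vertSpeed_corner hg hL hε hε1 hw (by linarith)
  rw [flight_corner, neg_inj, div_eq_iff hg.ne'] at hc
  have hx1 := abs_le.2 hx
  have hξ1 := abs_le.2 hξ
  have hc1 := cos_ge_of_abs_le_half (hx1.trans (by linarith))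
  have hc2 := cos_ge_of_abs_le_half (hξ1.trans (by linarith))
  have l1 := vertSpeed_le hg hL0.le (by linarith) Y (x := x)
  have l2 := vertSpeed_le hg hL0.le (by linarith) Y (x := ξ)
  have p1 : 0 ≤ vertSpeed g L x Y := Real.sqrt_nonneg _
  have p2 : 0 ≤ vertSpeed g L ξ Y := Real.sqrt_nonneg _
  have h2 : |Y * (vertSpeed g L x Y + vertSpeed g L ξ Y) / g| ≤ 4 / 3 * Real.pi := by
    rw [abs_div, abs_of_pos hg, div_le_iff₀ hg, abs_mul, abs_of_nonneg (add_nonneg p1 p2)]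
    have : |Y| * (vertSpeed g L x Y + vertSpeed g L ξ Y) ≤ w * (L + L) :=
      mul_le_mul (abs_le.2 hY) (by linarith) (by linarith) (by rw [hw]; positivity)
    linarith
  have h3 : |x - ξ| ≤ 2 * ε := abs_le.2 ⟨by linarith [hx.1, hξ.2], by linarith [hx.2, hξ.1]⟩
  have h4 := abs_add_le (x - ξ) (Y * (vertSpeed g L x Y + vertSpeed g L ξ Y) / g)
  unfold flight
  linarith [Real.pi_gt_three]

end Corner

/-! ### The return map in coordinates centred at the maxima. -/

/-- The maxima of `|sin|`. -/
noncomputable def centre (n : ℤ) : ℝ := Real.pi / 2 + n * Real.pi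

/-- A flight that lands with a vertical speed large compared to its angular velocity does not
meet the boundary before. -/
theorem isReturn_of_landing {g E : ℝ} {p : ℝ × ℝ} (hp : p ∈ sectionDown g E)
    (hs : Real.sin p.1 ≠ 0) {t : ℝ} (ht : 0 < t)
    (hen : angOut g E p ^ 2 + vertOut g E p ^ 2 = 2 * E - 2 * g * |Real.sin p.1|)
    (hland : |Real.sin (p.1 + angOut g E p * t)|
      = |Real.sin p.1| + vertOut g E p * t - g * t ^ 2 / 2)
    (hz : 2 * |angOut g E p| < vertOut g E p) (hQ : 2 * |angOut g E p| < g * t - vertOut g E p) :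
    IsReturn g E p (p.1 + angOut g E p * t, angOut g E p) := by
  set u := angOut g E p
  set z := vertOut g E p
  have hu := abs_nonneg u
  have henergy : 2 * E - 2 * g * |Real.sin (p.1 + u * t)| - u ^ 2 = (g * t - z) ^ 2 := by
    rw [hland]; linear_combination -hen
  have lip : ∀ a b, |Real.sin (p.1 + u * a)| - |Real.sin (p.1 + u * b)| ≤ |u| * |a - b| := by
    intro a b
    have h1 := Real.abs_sin_sub_sin_le (p.1 + u * a) (p.1 + u * b)
    rw [show p.1 + u * a - (p.1 + u * b) = u * (a - b) by ring, abs_mul] at h1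
    exact (abs_sub_abs_le_abs_sub _ _).trans h1
  refine ⟨hp, hs, ?_, t, ht, ?_, rfl, hland, rfl, ?_⟩
  · simp only [sectionDown, mem_ofPred_eq, henergy]
    have : 0 < g * t - z := by linarith
    positivity
  · intro s hs0 hst
    -- Since `|sin|` is 1-Lipschitz, the boundary height below the particle changes at rate at most
    -- |u|. While rising, the particle has gained at least zs/2; while falling, it is still at least
    -- (gt - z)(t - s)/2 above the landing height.
    rcases le_or_gt (g * s) z with h | h
    · have h1 := lip s 0
      rw [mul_zero, add_zero, sub_zero, abs_of_pos hs0] at h1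
      have h2 : s * (g * s) ≤ s * z := mul_le_mul_of_nonneg_left h hs0.le
      have h3 : s * (2 * |u|) < s * z := mul_lt_mul_of_pos_left hz hs0
      nlinarith
    · have h1 := lip s t
      rw [abs_sub_comm, abs_of_pos (sub_pos.2 hst), hland] at h1
      have hr : 0 < t - s := sub_pos.2 hst
      have h2 : (t - s) * (g * (t - s)) < (t - s) * (g * t - z) :=
        mul_lt_mul_of_pos_left (by linarith) hr
      have h3 : (t - s) * (2 * |u|) < (t - s) * (g * t - z) := mul_lt_mul_of_pos_left hQ hr
      nlinarith
  · rw [vertIn]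
    simp only
    rw [henergy, Real.sqrt_sq (by linarith)]
    ring

section Centre

variable {g E L x v : ℝ} (n : ℤ)

theorem neg_one_zpow_abs : |(-1 : ℝ) ^ n| = 1 := by
  rw [abs_zpow, abs_neg, abs_one, one_zpow]

theorem sin_centre_add (x : ℝ) : Real.sin (centre n + x) = (-1) ^ n * Real.cos x := by
  rw [centre, show Real.pi / 2 + n * Real.pi + x = x + Real.pi / 2 + n * Real.pi by ring,
    Real.sin_add_int_mul_pi, Real.sin_add_pi_div_two]

theorem cos_centre_add (x : ℝ) : Real.cos (centre n + x) = (-1) ^ n * -Real.sin x := by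
  rw [centre, show Real.pi / 2 + n * Real.pi + x = x + Real.pi / 2 + n * Real.pi by ring,
    Real.cos_add_int_mul_pi, Real.cos_add_pi_div_two]

theorem abs_sin_centre_add (hx : |x| ≤ 1 / 2) : |Real.sin (centre n + x)| = Real.cos x := by
  rw [sin_centre_add, abs_mul, neg_one_zpow_abs, one_mul, abs_of_nonneg]
  linarith [cos_ge_of_abs_le_half hx]

theorem neg_one_zpow_sq : ((-1 : ℝ) ^ n) ^ 2 = 1 := by
  rw [← sq_abs, neg_one_zpow_abs, one_pow]

theorem vertIn_centre (hE : 2 * E = L ^ 2) (hx : |x| ≤ 1 / 2) :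
    vertIn g E (centre n + x, v) = -vertSpeed g L x v := by
  simp only [vertIn, vertSpeed, abs_sin_centre_add n hx, hE]

theorem cos_mul_sign_centre (hx : |x| ≤ 1 / 2) :
    Real.cos (centre n + x) * (Real.sin (centre n + x) / |Real.sin (centre n + x)|)
      = -Real.sin x := by
  have hc : Real.cos x ≠ 0 := by linarith [cos_ge_of_abs_le_half hx]
  rw [abs_sin_centre_add n hx, sin_centre_add, cos_centre_add, mul_div_cancel_right₀ _ hc]
  linear_combination (-Real.sin x) * neg_one_zpow_sq n

theorem sin_sq_centre (x : ℝ) : Real.sin (centre n + x) ^ 2 = Real.cos x ^ 2 := by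
  rw [sin_centre_add, mul_pow, neg_one_zpow_sq, one_mul]

theorem cos_sq_centre (x : ℝ) : Real.cos (centre n + x) ^ 2 = Real.sin x ^ 2 := by
  rw [cos_centre_add, mul_pow, neg_one_zpow_sq, one_mul, neg_sq]

theorem angOut_centre (hE : 2 * E = L ^ 2) (hx : |x| ≤ 1 / 2) :
    angOut g E (centre n + x, v) = angRefl g L x v := by
  simp only [angOut, angRefl, vertIn_centre n hE hx, sin_sq_centre, cos_sq_centre]
  rw [mul_assoc 2, cos_mul_sign_centre n hx]
  ring

theorem vertOut_centre (hE : 2 * E = L ^ 2) (hx : |x| ≤ 1 / 2) :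
    vertOut g E (centre n + x, v) = vertRefl g L x v := by
  simp only [vertOut, vertRefl, vertIn_centre n hE hx, sin_sq_centre, cos_sq_centre]
  rw [mul_assoc 2, cos_mul_sign_centre n hx]
  ring

theorem mem_sectionDown_centre (hg : 0 < g) (hL : 100 * (1 + g) ≤ L) (hE : 2 * E = L ^ 2)
    (hx : |x| ≤ 1 / 2) (hv : |v| ≤ 1) : (centre n + x, v) ∈ sectionDown g E := by
  have h := vertSpeed_radicand_ge hg hL x hv
  have : 0 < (19 / 20 * L) ^ 2 := by
    have : 0 < L := by linarith
    positivity
  simp only [sectionDown, mem_ofPred_eq, abs_sin_centre_add n hx, hE]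
  linarith

theorem energy_centre (hg : 0 < g) (hL : 100 * (1 + g) ≤ L) (hE : 2 * E = L ^ 2)
    (hx : |x| ≤ 1 / 2) (hv : |v| ≤ 1) :
    angOut g E (centre n + x, v) ^ 2 + vertOut g E (centre n + x, v) ^ 2
      = 2 * E - 2 * g * |Real.sin (centre n + x)| := by
  rw [angOut_centre n hE hx, vertOut_centre n hE hx, abs_sin_centre_add n hx, hE,
    angRefl_sq_add_vertRefl_sq hg hL hv]

theorem two_mul_abs_angOut_lt (hg : 0 < g) (hL : 100 * (1 + g) ≤ L) (hE : 2 * E = L ^ 2)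
    (hx : |x| ≤ 1 / 2) (hv : |v| ≤ 1) (hU : |angRefl g L x v| ≤ 1) :
    2 * |angOut g E (centre n + x, v)| < vertOut g E (centre n + x, v) := by
  have := vertSpeed_ge hg hL x hU
  rw [angOut_centre n hE hx, vertOut_centre n hE hx, vertRefl_eq hg hL hx hv]
  linarith

theorem exists_isReturn (hg : 0 < g) (hL : 100 * (1 + g) ≤ L) (hE : 2 * E = L ^ 2)
    (hx : |x| ≤ 1 / 2) (hv : |v| ≤ 1) (hU : |angRefl g L x v| ≤ 1) :
    ∃ q, IsReturn g E (centre n + x, v) q := by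
  have hen := energy_centre n hg hL hE hx hv
  have hz := two_mul_abs_angOut_lt n hg hL hE hx hv hU
  have hu1 : |angOut g E (centre n + x, v)| ≤ 1 := by rwa [angOut_centre n hE hx]
  have hzL : 19 / 20 * L ≤ vertOut g E (centre n + x, v) := by
    rw [vertOut_centre n hE hx, vertRefl_eq hg hL hx hv]
    exact vertSpeed_ge hg hL x hU
  set p : ℝ × ℝ := (centre n + x, v) with hp
  have hsin : |Real.sin p.1| = Real.cos x := abs_sin_centre_add n hx
  have hcos := cos_ge_of_abs_le_half hx
  set u := angOut g E p
  set z := vertOut g E p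
  have hz0 : 0 < z := by linarith
  have cont : Continuous fun s => |Real.sin (p.1 + u * s)|
      - (|Real.sin p.1| + z * s - g * s ^ 2 / 2) := by fun_prop
  -- At the apex, time z/g, the particle has risen by z²/(2g) ≥ 1; at time 3z/g it is 3z²/(2g) ≥ 1
  -- below its start. Starting at the apex avoids the trivial zero at time 0.
  have hlo : |Real.sin (p.1 + u * (z / g))|
      - (|Real.sin p.1| + z * (z / g) - g * (z / g) ^ 2 / 2) ≤ 0 := by
    have h1 := Real.abs_sin_le_one (p.1 + u * (z / g))
    have h2 : z * (z / g) - g * (z / g) ^ 2 / 2 = z ^ 2 / (2 * g) := by field_simp; ring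
    have h3 : 1 ≤ z ^ 2 / (2 * g) := by
      rw [le_div_iff₀ (by positivity)]
      nlinarith
    linarith
  have hhi : 0 ≤ |Real.sin (p.1 + u * (3 * z / g))|
      - (|Real.sin p.1| + z * (3 * z / g) - g * (3 * z / g) ^ 2 / 2) := by
    have h1 := abs_nonneg (Real.sin (p.1 + u * (3 * z / g)))
    have h2 : z * (3 * z / g) - g * (3 * z / g) ^ 2 / 2 = -(3 * z ^ 2 / (2 * g)) := by
      field_simp; ring
    have h3 : 1 ≤ 3 * z ^ 2 / (2 * g) := by
      rw [le_div_iff₀ (by positivity)]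
      nlinarith
    linarith [Real.abs_sin_le_one p.1]
  obtain ⟨t, ht, h0⟩ := intermediate_value_Icc
    (by gcongr; linarith : z / g ≤ 3 * z / g) cont.continuousOn ⟨hlo, hhi⟩
  have hzt : 0 ≤ g * t - z := by
    have := (div_le_iff₀ hg).1 ht.1
    linarith
  have ht0 : 0 < t := lt_of_lt_of_le (by positivity) ht.1
  have hland : |Real.sin (p.1 + u * t)| = |Real.sin p.1| + z * t - g * t ^ 2 / 2 := by
    simp only at h0
    linarith
  refine ⟨_, isReturn_of_landing (mem_sectionDown_centre n hg hL hE hx hv) ?_ ht0 hen hland hz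
    ?_⟩
  · rw [← abs_pos, hsin]; linarith
  · have h1 : (g * t - z) ^ 2 = 2 * E - 2 * g * |Real.sin (p.1 + u * t)| - u ^ 2 := by
      rw [hland]; linear_combination hen
    have h2 : u ^ 2 ≤ 1 := by simpa using sq_le_sq' (abs_le.1 hu1).1 (abs_le.1 hu1).2
    have h3 := mul_le_mul_of_nonneg_left (Real.abs_sin_le_one (p.1 + u * t)) hg.le
    have h4 : (2 : ℝ) ^ 2 < (g * t - z) ^ 2 := by
      rw [h1, hE]; nlinarith
    have h5 := lt_of_pow_lt_pow_left₀ 2 hzt h4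
    show 2 * |u| < g * t - z
    linarith

/-- Of two different return times, the earlier would be a boundary contact during the free flight up
to the later. -/
theorem IsReturn.unique {p q q' : ℝ × ℝ} (h : IsReturn g E p q) (h' : IsReturn g E p q') :
    q = q' := by
  obtain ⟨-, -, -, t, ht, hs, h1, h2, h3, -⟩ := h
  obtain ⟨-, -, -, t', ht', hs', h1', h2', h3', -⟩ := h'
  have : t = t' := by
    rcases lt_trichotomy t t' with hlt | h | hlt
    · have := hs' t ht hlt
      rw [← h1, h2] at this
      exact absurd this (lt_irrefl _)
    · exact h
    · have := hs t' ht' hlt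
      rw [← h1', h2'] at this
      exact absurd this (lt_irrefl _)
  subst this
  exact Prod.ext (h1.trans h1'.symm) (h3.trans h3'.symm)

/-- The velocities at departure and arrival fix the time of flight, so only the horizontal
displacement remains to be matched; the landing height then follows from conservation of energy. -/
theorem isReturn_centre_iff (hg : 0 < g) (hL : 100 * (1 + g) ≤ L) (hE : 2 * E = L ^ 2)
    (m : ℤ) {ξ Y : ℝ} (hx : |x| ≤ 1 / 2) (hv : |v| ≤ 1) (hU : |angRefl g L x v| ≤ 1)
    (hξ : |ξ| ≤ 1 / 2) :
    IsReturn g E (centre n + x, v) (centre m + ξ, Y) ↔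
      Y = angRefl g L x v ∧ flight g L x ξ Y = (m - n) * Real.pi := by
  have hang := angOut_centre (g := g) (v := v) n hE hx
  have hvert := vertOut_centre (g := g) (v := v) n hE hx
  rw [vertRefl_eq hg hL hx hv] at hvert
  have hcm : centre m - centre n = (m - n) * Real.pi := by unfold centre; ring
  constructor
  · rintro ⟨-, -, -, t, -, -, h1, -, h3, h4⟩
    simp only at h1 h3
    rw [hang] at h1 h3
    refine ⟨h3, ?_⟩
    rw [vertIn_centre m hE hξ, hvert, ← h3] at h4
    have ht : t = (vertSpeed g L x Y + vertSpeed g L ξ Y) / g := by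
      rw [eq_div_iff hg.ne']; linarith
    rw [← h3] at h1
    rw [← hcm, flight, mul_div_assoc, ← ht]
    linarith
  · rintro ⟨rfl, hG⟩
    set Y := angRefl g L x v
    have e1 := vertSpeed_sq hg hL x hU
    have e2 := vertSpeed_sq hg hL ξ hU
    have l1 := vertSpeed_ge hg hL x hU
    have l2 := vertSpeed_ge hg hL ξ hU
    have hz := two_mul_abs_angOut_lt n hg hL hE hx hv hU
    set t := (vertSpeed g L x Y + vertSpeed g L ξ Y) / g with ht
    have hgt : g * t = vertSpeed g L x Y + vertSpeed g L ξ Y := by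
      rw [ht]; field_simp
    have ht0 : 0 < t := div_pos (by linarith) hg
    have hpos : centre n + x + Y * t = centre m + ξ := by
      have : flight g L x ξ Y = x - ξ + Y * t := by rw [flight, mul_div_assoc]
      linarith
    have hland : |Real.sin (centre n + x + Y * t)|
        = |Real.sin (centre n + x)| + vertSpeed g L x Y * t - g * t ^ 2 / 2 := by
      rw [hpos, abs_sin_centre_add m hξ, abs_sin_centre_add n hx]
      refine mul_left_cancel₀ (by positivity : 2 * g ≠ 0) ?_
      linear_combination e2 - e1 + (g * t - vertSpeed g L x Y + vertSpeed g L ξ Y) * hgt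
    have hcos := cos_ge_of_abs_le_half hx
    have := isReturn_of_landing (mem_sectionDown_centre n hg hL hE hx hv)
      (by rw [← abs_pos]; simp only [abs_sin_centre_add n hx]; linarith) ht0
      (energy_centre n hg hL hE hx hv) (by rw [hang, hvert]; exact hland) hz
      (by rw [hang, hvert, hgt]; linarith)
    rw [hang] at this
    simp only [hpos] at this
    exact this

end Centre

/-! ### Images of the rectangles about all the maxima. -/

/-- The rectangle with angular centre `centre n`. -/
def cell (g E ε w : ℝ) (n : ℤ) : Set (ℝ × ℝ) :=
  {p | p ∈ sectionDown g E ∧ |p.1 - centre n| ≤ ε ∧ |p.2| ≤ w}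

/-- The part of the image of the rectangle with centre `centre n` which lies in the one with centre
`centre (n + j)`. -/
def cellImage (g L ε w : ℝ) (n j : ℤ) : Set (ℝ × ℝ) :=
  {q | (q.1 - centre (n + j), q.2) ∈ imagePart g L ε w (j * Real.pi)}

theorem IsHorizontalStrip.translate {μ X₀ X₁ Y₀ Y₁ : ℝ} {H : Set (ℝ × ℝ)}
    (h : IsHorizontalStrip μ X₀ X₁ Y₀ Y₁ H) (a : ℝ) :
    IsHorizontalStrip μ (a + X₀) (a + X₁) Y₀ Y₁ {q | (q.1 - a, q.2) ∈ H} := by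
  obtain ⟨h₁, h₂, c₁, c₂, hlt, rfl⟩ := h
  have mem : ∀ X, X ∈ Icc (a + X₀) (a + X₁) ↔ X - a ∈ Icc X₀ X₁ := fun X => by
    simp only [mem_Icc]
    constructor <;> rintro ⟨h1, h2⟩ <;> constructor <;> linarith
  have curve : ∀ h, IsHorizontalCurve μ X₀ X₁ Y₀ Y₁ h →
      IsHorizontalCurve μ (a + X₀) (a + X₁) Y₀ Y₁ fun X => h (X - a) := by
    rintro h ⟨hr, hl⟩
    refine ⟨fun X hX => hr _ ((mem X).1 hX), fun X hX X' hX' => ?_⟩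
    have := hl _ ((mem X).1 hX) _ ((mem X').1 hX')
    rwa [sub_sub_sub_cancel_right] at this
  refine ⟨_, _, curve h₁ c₁, curve h₂ c₂, fun X hX => hlt _ ((mem X).1 hX), ?_⟩
  ext q
  simp only [mem_ofPred_eq, mem]

theorem domL_eq_cell (g E k : ℝ) :
    domL g E k = cell g E (k / E) (Real.sqrt 2 * k / Real.sqrt E) 0 := by
  simp [domL, cell, centre]

theorem domR_eq_cell (g E k : ℝ) :
    domR g E k = cell g E (k / E) (Real.sqrt 2 * k / Real.sqrt E) 1 := by
  have : 3 * Real.pi / 2 = centre 1 := by simp only [centre, Int.cast_one]; ring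
  rw [domR, cell, this]

theorem mem_cell_add {g E ε w : ℝ} (n m : ℤ) (p : ℝ × ℝ) :
    (p.1 + 2 * Real.pi * m, p.2) ∈ cell g E ε w (n + 2 * m) ↔ p ∈ cell g E ε w n := by
  have h1 : p.1 + 2 * Real.pi * m - centre (n + 2 * m) = p.1 - centre n := by
    simp only [centre]; push_cast; ring
  have h2 : Real.sin (p.1 + 2 * Real.pi * m) = Real.sin p.1 := by
    rw [mul_comm (2 * Real.pi), Real.sin_add_int_mul_two_pi]
  simp only [cell, sectionDown, mem_ofPred_eq, h1, h2]

/-- Even indices are the translates of D_L, odd ones those of D_R. -/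
theorem domTranslates_eq_iUnion_cell (g E k : ℝ) :
    domTranslates g E k = ⋃ n, cell g E (k / E) (Real.sqrt 2 * k / Real.sqrt E) n := by
  ext q
  simp only [domTranslates, dom, domL_eq_cell, domR_eq_cell, mem_iUnion, mem_image]
  constructor
  · rintro ⟨m, p, hp | hp, rfl⟩
    · exact ⟨_, (mem_cell_add 0 m p).2 hp⟩
    · exact ⟨_, (mem_cell_add 1 m p).2 hp⟩
  · rintro ⟨n, hn⟩
    have hq : ∀ m : ℤ, q = ((q.1 - 2 * Real.pi * m) + 2 * Real.pi * m, q.2) := fun m => by simp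
    rcases Int.even_or_odd' n with ⟨m, rfl | rfl⟩
    · refine ⟨m, (q.1 - 2 * Real.pi * m, q.2), Or.inl ?_, (hq m).symm⟩
      rw [hq m, ← zero_add (2 * m)] at hn
      exact (mem_cell_add 0 m (q.1 - 2 * Real.pi * m, q.2)).1 hn
    · refine ⟨m, (q.1 - 2 * Real.pi * m, q.2), Or.inr ?_, (hq m).symm⟩
      rw [hq m, add_comm (2 * m)] at hn
      exact (mem_cell_add 1 m (q.1 - 2 * Real.pi * m, q.2)).1 hn

section Image

variable {g E L ε w : ℝ}

theorem returnImage_cell (hg : 0 < g) (hL : 100 * (1 + g) ≤ L) (hE : 2 * E = L ^ 2) (hε : 0 < ε)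
    (hε1 : ε ≤ 1 / 50) (hw : w = ε * L) (hw1 : w ≤ 1 / 50)
    (hc : flight g L (-ε) (-ε) (angRefl g L (-ε) w) = -Real.pi) (n : ℤ) :
    returnImage g E (cell g E ε w n) ∩ ⋃ m, cell g E ε w m
      = cellImage g L ε w n (-1) ∪ cellImage g L ε w n 0 ∪ cellImage g L ε w n 1 := by
  have absx : ∀ x, |x| ≤ ε → |x| ≤ 1 / 2 := fun x hx => by linarith
  have absv : ∀ x, |x| ≤ w → |x| ≤ 1 := fun x hx => by linarith
  have hU : ∀ x v, |x| ≤ ε → |v| ≤ w → |angRefl g L x v| ≤ 1 := fun x v hx hv =>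
    abs_angRefl_le_one hg hL hε1 hw hw1 (abs_le.1 hx) (abs_le.1 hv)
  have back : ∀ j : ℤ, cellImage g L ε w n j
      ⊆ returnImage g E (cell g E ε w n) ∩ ⋃ m, cell g E ε w m := by
    rintro j ⟨X, Y⟩ ⟨hξ, hY, x, hx, v, hv, e, hG⟩
    simp only at hξ hY e hG
    rw [mem_Icc, ← abs_le] at hξ hY hx hv
    have hq : (X, Y) = (centre (n + j) + (X - centre (n + j)), Y) := by simp
    refine ⟨⟨(centre n + x, v), ⟨mem_sectionDown_centre n hg hL hE (absx x hx) (absv v hv),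
      by simpa using hx, hv⟩, ?_⟩, mem_iUnion.2 ⟨n + j, ?_, hξ, hY⟩⟩
    · rw [hq, isReturn_centre_iff n hg hL hE (n + j) (absx x hx) (absv v hv) (hU x v hx hv)
        (absx _ hξ)]
      refine ⟨e, hG.trans ?_⟩
      push_cast; ring
    · rw [hq]
      exact mem_sectionDown_centre _ hg hL hE (absx _ hξ) (absv _ hY)
  refine Subset.antisymm ?_ (union_subset (union_subset (back _) (back _)) (back _))
  rintro ⟨X, Y⟩ ⟨⟨⟨θ, v⟩, ⟨-, hx, hv⟩, hret⟩, hm⟩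
  obtain ⟨m, -, hξ, hY⟩ := mem_iUnion.1 hm
  simp only at hx hv hξ hY
  rw [show θ = centre n + (θ - centre n) by ring, show X = centre m + (X - centre m) by ring,
    isReturn_centre_iff n hg hL hE m (absx _ hx) (absv v hv) (hU _ v hx hv) (absx _ hξ)] at hret
  obtain ⟨e, hG⟩ := hret
  obtain ⟨j, rfl⟩ : ∃ j, m = n + j := ⟨m - n, by ring⟩
  have hG' : flight g L (θ - centre n) (X - centre (n + j)) Y = j * Real.pi := by
    rw [hG]; push_cast; ring
  have hj := abs_flight_lt_two_pi hg hL hε hε1 hw hw1 hc (abs_le.1 hx) (abs_le.1 hξ)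
    (abs_le.1 hY)
  rw [hG', abs_mul, abs_of_pos Real.pi_pos, mul_lt_mul_iff_left₀ Real.pi_pos] at hj
  have hj2 : |j| < 2 := by exact_mod_cast hj
  have mem : (X, Y) ∈ cellImage g L ε w n j :=
    ⟨abs_le.1 hξ, abs_le.1 hY, _, abs_le.1 hx, _, abs_le.1 hv, e, hG'⟩
  rw [abs_lt] at hj2
  have : j = -1 ∨ j = 0 ∨ j = 1 := by omega
  rcases this with rfl | rfl | rfl
  · exact Or.inl (Or.inl mem)
  · exact Or.inl (Or.inr mem)
  · exact Or.inr mem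

/-- Strips in different rectangles are apart because the centres are at least π apart; strips in the
same rectangle have different flight lengths. -/
theorem disjoint_cellImage (hg : 0 < g) (hL : 100 * (1 + g) ≤ L)
    (hε1 : ε ≤ 1 / 50) (hw1 : w ≤ 1 / 50) {n j n' j' : ℤ} (h : (n, j) ≠ (n', j')) :
    Disjoint (cellImage g L ε w n j) (cellImage g L ε w n' j') := by
  have gap : ∀ i i' : ℤ, i ≠ i' → 1 < |(i : ℝ) * Real.pi - i' * Real.pi| := by
    intro i i' hne
    rw [← sub_mul, abs_mul, abs_of_pos Real.pi_pos]
    have : (1 : ℝ) ≤ |(i : ℝ) - i'| := by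
      exact_mod_cast Int.one_le_abs (sub_ne_zero.2 hne)
    nlinarith [Real.pi_gt_three]
  rw [Set.disjoint_left]
  rintro ⟨X, Y⟩ hq hq'
  by_cases hs : n + j = n' + j'
  · have hj : j ≠ j' := by
      rintro rfl
      exact h (by rw [add_right_cancel hs])
    refine (disjoint_imagePart hg hL hε1 hw1 (gap j j' hj)).notMem_of_mem_left hq ?_
    simp only [cellImage, mem_ofPred_eq] at hq'
    rwa [hs]
  · have h1 := abs_le.2 hq.1
    have h2 := abs_le.2 hq'.1
    simp only at h1 h2
    have h3 := gap _ _ hs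
    have h4 := abs_sub_le (centre (n + j)) X (centre (n' + j'))
    rw [abs_sub_comm _ X] at h4
    have h5 : centre (n + j) - centre (n' + j')
        = ((n + j : ℤ) : ℝ) * Real.pi - ((n' + j' : ℤ) : ℝ) * Real.pi := by
      unfold centre; ring
    rw [h5] at h4
    linarith

theorem isHorizontalStrip_cellImage (hg : 0 < g) (hL : 100 * (1 + g) ≤ L) (hε : 0 < ε)
    (hε1 : ε ≤ 1 / 50) (hw : w = ε * L) (hw1 : w ≤ 1 / 50)
    (hc : flight g L (-ε) (-ε) (angRefl g L (-ε) w) = -Real.pi) (n : ℤ) {j : ℤ} (hj : |j| ≤ 1) :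
    IsHorizontalStrip (2 * g / L) (centre (n + j) - ε) (centre (n + j) + ε) (-w) w
      (cellImage g L ε w n j) := by
  refine (isHorizontalStrip_of_corner hg hL hε hε1 hw hw1 hc ?_).translate _
  rw [abs_mul, abs_of_pos Real.pi_pos]
  have : |(j : ℝ)| ≤ 1 := by exact_mod_cast hj
  exact mul_le_of_le_one_left Real.pi_pos.le this

theorem existsUnique_isReturn_cell (hg : 0 < g) (hL : 100 * (1 + g) ≤ L) (hE : 2 * E = L ^ 2)
    (hε1 : ε ≤ 1 / 50) (hw : w = ε * L) (hw1 : w ≤ 1 / 50) {n : ℤ} {p : ℝ × ℝ}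
    (hp : p ∈ cell g E ε w n) : ∃! q, IsReturn g E p q := by
  obtain ⟨-, hx, hv⟩ := hp
  obtain ⟨q, hq⟩ := exists_isReturn n hg hL hE (by linarith) (by linarith)
    (abs_angRefl_le_one hg hL hε1 hw hw1 (abs_le.1 hx) (abs_le.1 hv))
  rw [add_sub_cancel] at hq
  exact ⟨q, hq, fun q' hq' => hq'.unique hq⟩

end Image

/-! ### The corner equation and the choice of constants. -/

theorem cornerEq_eq {g E L k : ℝ} (hE : 2 * E = L ^ 2) (hk : |k / E| ≤ 1 / 2) :
    cornerEq g E k = flight g L (-(k / E)) (-(k / E))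
      (angRefl g L (-(k / E)) (Real.sqrt 2 * k / Real.sqrt E)) + Real.pi := by
  have h : Real.pi / 2 - k / E = centre 0 + -(k / E) := by simp [centre]; ring
  have hx : |-(k / E)| ≤ 1 / 2 := by rwa [abs_neg]
  simp only [cornerEq, h, angOut_centre 0 hE hx, abs_sin_centre_add 0 hx, hE, flight, vertSpeed]
  ring

theorem half_width_bounds {g E k K : ℝ} (hg : 0 < g) (hE0 : 0 < E)
    (hE : 100 * (1 + g) + 100 * K ≤ Real.sqrt (2 * E)) (hk : 0 < k) (hkK : k ≤ K) :
    0 < k / E ∧ k / E ≤ 1 / 50 ∧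
      Real.sqrt 2 * k / Real.sqrt E = k / E * Real.sqrt (2 * E) ∧
      Real.sqrt 2 * k / Real.sqrt E ≤ 1 / 50 ∧
      Real.sqrt 2 * k / Real.sqrt E * Real.sqrt (2 * E) = 2 * k := by
  have hs : Real.sqrt (2 * E) = Real.sqrt 2 * Real.sqrt E := Real.sqrt_mul (by norm_num) E
  have hsE : 0 < Real.sqrt E := Real.sqrt_pos.2 hE0
  have e : Real.sqrt E ^ 2 = E := Real.sq_sqrt hE0.le
  have e2 : Real.sqrt 2 ^ 2 = 2 := Real.sq_sqrt (by norm_num)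
  have h1 : Real.sqrt 2 * k / Real.sqrt E = k / E * Real.sqrt (2 * E) := by
    rw [hs, div_mul_eq_mul_div, div_eq_div_iff hsE.ne' hE0.ne']
    linear_combination (-(Real.sqrt 2 * k)) * e
  have h2 : Real.sqrt 2 * k / Real.sqrt E * Real.sqrt (2 * E) = 2 * k := by
    rw [hs]
    field_simp
    linear_combination e2
  have hε : 0 < k / E := div_pos hk hE0
  have h3 : Real.sqrt 2 * k / Real.sqrt E ≤ 1 / 50 := by
    by_contra! hc
    have := mul_lt_mul_of_pos_right hc (by linarith : 0 < Real.sqrt (2 * E))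
    linarith
  refine ⟨hε, ?_, h1, h3, h2⟩
  rw [h1] at h3
  nlinarith

theorem exists_cornerEq_eq_zero {g E K : ℝ} (hg : 0 < g) (hE0 : 0 < E)
    (hE : 100 * (1 + g) + 100 * K ≤ Real.sqrt (2 * E)) (hK : g * Real.pi / 2 ≤ K) :
    ∃ k ∈ Ioo (g * Real.pi / 8) (g * Real.pi / 2), cornerEq g E k = 0 := by
  have hgπ : 0 < g * Real.pi := by positivity
  have hL : 100 * (1 + g) ≤ Real.sqrt (2 * E) := by linarith
  have hE2 : 2 * E = Real.sqrt (2 * E) ^ 2 := (Real.sq_sqrt (by linarith)).symm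
  have bounds : ∀ k ∈ Icc (g * Real.pi / 8) (g * Real.pi / 2), _ := fun k hk =>
    half_width_bounds (k := k) hg hE0 hE (by linarith [hk.1]) (by linarith [hk.2])
  set L := Real.sqrt (2 * E)
  have value : ∀ k ∈ Icc (g * Real.pi / 8) (g * Real.pi / 2), cornerEq g E k = _ := fun k hk =>
    cornerEq_eq hE2 (by rw [abs_of_pos (bounds k hk).1]; linarith [(bounds k hk).2.1])
  have cont : ContinuousOn (cornerEq g E) (Icc (g * Real.pi / 8) (g * Real.pi / 2)) := by
    refine ContinuousOn.congr (Continuous.continuousOn ?_) value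
    have h1 := continuous_angRefl (g := g) (L := L)
    have h2 := continuous_flight (g := g) (L := L)
    have h3 : Continuous fun k : ℝ =>
        angRefl g L (-(k / E)) (Real.sqrt 2 * k / Real.sqrt E) :=
      h1.comp (f := fun k : ℝ => (-(k / E), Real.sqrt 2 * k / Real.sqrt E)) (by fun_prop)
    exact (h2.comp (f := fun k : ℝ => (-(k / E), -(k / E),
      angRefl g L (-(k / E)) (Real.sqrt 2 * k / Real.sqrt E))) (by fun_prop)).add continuous_const
  have m1 : g * Real.pi / 8 ∈ Icc (g * Real.pi / 8) (g * Real.pi / 2) := ⟨le_rfl, by linarith⟩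
  have m2 : g * Real.pi / 2 ∈ Icc (g * Real.pi / 8) (g * Real.pi / 2) := ⟨by linarith, le_rfl⟩
  -- As wL = 2k, the product mS of `flight_corner` lies between 3k/2 and 2k. So 2mS/g is at most π/2
  -- at k = gπ/8 and at least 3π/2 at k = gπ/2.
  have p1 : 0 < cornerEq g E (g * Real.pi / 8) := by
    obtain ⟨b1, b2, b3, b4, b5⟩ := bounds _ m1
    have := mul_vertSpeed_corner_le hg hL b1 b2 b3
    rw [value _ m1, flight_corner, neg_add_eq_sub, sub_pos, div_lt_iff₀ hg]
    linarith
  have p2 : cornerEq g E (g * Real.pi / 2) < 0 := by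
    obtain ⟨b1, b2, b3, b4, b5⟩ := bounds _ m2
    have := le_mul_vertSpeed_corner hg hL b1 b2 b3 (by linarith)
    rw [value _ m2, flight_corner, neg_add_eq_sub, sub_neg, lt_div_iff₀ hg]
    linarith
  obtain ⟨k, hk, h0⟩ := intermediate_value_Ioo' m1.2 cont ⟨p2, p1⟩
  exact ⟨k, hk, h0⟩

/-- The rectangle of departure of each of the six strips. -/
def stripSource : Fin 6 → ℤ := ![0, 0, 0, 1, 1, 1]

/-- The number of half turns made during the flight to each of the six strips. -/
def stripShift : Fin 6 → ℤ := ![-1, 0, 1, -1, 0, 1]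

theorem stripCentre_eq (i : Fin 6) : stripCentre i = centre (stripSource i + stripShift i) := by
  fin_cases i <;> simp [stripCentre, stripSource, stripShift, centre] <;> ring

end CoinBilliard

theorem proposition4p5 (g : ℝ) (hg : 0 < g) (k₁ k₂ : ℝ) (hk₁ : 0 < k₁) (hk₁₂ : k₁ < k₂) :
    ∃ C : ℝ, 0 < C ∧ ∃ E₀ : ℝ, 0 < E₀ ∧ ∀ E : ℝ, E₀ ≤ E →
      (∃ k ∈ Set.Ioo (g * Real.pi / 8) (g * Real.pi / 2), CoinBilliard.cornerEq g E k = 0) ∧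
      ∀ k ∈ Set.Ioo k₁ k₂, CoinBilliard.cornerEq g E k = 0 →
        (∀ p ∈ CoinBilliard.dom g E k, ∃! q : ℝ × ℝ, CoinBilliard.IsReturn g E p q) ∧
        ∃ μ : ℝ, 0 ≤ μ ∧ μ ≤ C / Real.sqrt E ∧
        ∃ H : Fin 6 → Set (ℝ × ℝ),
          (∀ i, CoinBilliard.IsHorizontalStrip μ
            (CoinBilliard.stripCentre i - k / E) (CoinBilliard.stripCentre i + k / E)
            (-(Real.sqrt 2 * k / Real.sqrt E)) (Real.sqrt 2 * k / Real.sqrt E) (H i)) ∧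
          Pairwise (fun i j => Disjoint (H i) (H j)) ∧
          CoinBilliard.returnImage g E (CoinBilliard.domL g E k)
            ∩ CoinBilliard.domTranslates g E k = H 0 ∪ H 1 ∪ H 2 ∧
          CoinBilliard.returnImage g E (CoinBilliard.domR g E k)
            ∩ CoinBilliard.domTranslates g E k = H 3 ∪ H 4 ∪ H 5 ∧
          CoinBilliard.returnImage g E (CoinBilliard.dom g E k)
            ∩ CoinBilliard.domTranslates g E k = ⋃ i, H i := by
  open CoinBilliard in
  have hk₂ : 0 < k₂ := hk₁.trans hk₁₂
  have hgπ : 0 < g * Real.pi := by positivity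
  -- The sum k₂ + gπ bounds both the given range of k and the interval where a zero of A is sought.
  -- The slope 2g/L is at most 2g/√E, whence C = 2g.
  set M := 100 * (1 + g) + 100 * (k₂ + g * Real.pi) with hM
  have hM0 : 0 < M := by positivity
  refine ⟨2 * g, by positivity, M ^ 2, by positivity, fun E hEM => ?_⟩
  have hE0 : 0 < E := lt_of_lt_of_le (by positivity) hEM
  have hML : M ≤ Real.sqrt (2 * E) := Real.le_sqrt_of_sq_le (by linarith)
  refine ⟨exists_cornerEq_eq_zero hg hE0 hML (by linarith), fun k hk hcorner => ?_⟩
  obtain ⟨hε, hε1, hw, hw1, -⟩ := half_width_bounds (k := k) hg hE0 hML (hk₁.trans hk.1)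
    (by linarith [hk.2])
  have hL : 100 * (1 + g) ≤ Real.sqrt (2 * E) := by linarith
  have hE2 : 2 * E = Real.sqrt (2 * E) ^ 2 := (Real.sq_sqrt (by linarith)).symm
  have hLE : Real.sqrt E ≤ Real.sqrt (2 * E) := Real.sqrt_le_sqrt (by linarith)
  have hc := hcorner
  rw [cornerEq_eq hE2 (by rw [abs_of_pos hε]; linarith)] at hc
  replace hc := eq_neg_of_add_eq_zero_left hc
  rw [dom, domTranslates_eq_iUnion_cell, domL_eq_cell, domR_eq_cell]
  set L := Real.sqrt (2 * E)
  set ε := k / E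
  set w := Real.sqrt 2 * k / Real.sqrt E
  have hL0 : 0 < L := by linarith
  have imL := returnImage_cell hg hL hE2 hε hε1 hw hw1 hc 0
  have imR := returnImage_cell hg hL hE2 hε hε1 hw hw1 hc 1
  refine ⟨?_, 2 * g / L, by positivity, ?_,
    fun i => cellImage g L ε w (stripSource i) (stripShift i), fun i => ?_, fun i j hij => ?_,
    imL, imR, ?_⟩
  · rintro p (hp | hp)
    · exact existsUnique_isReturn_cell hg hL hE2 hε1 hw hw1 hp
    · exact existsUnique_isReturn_cell hg hL hE2 hε1 hw hw1 hp
  · exact div_le_div_of_nonneg_left (by positivity) (Real.sqrt_pos.2 hE0) hLE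
  · rw [stripCentre_eq]
    exact isHorizontalStrip_cellImage hg hL hε hε1 hw hw1 hc _ (by revert i; decide)
  · refine disjoint_cellImage hg hL hε1 hw1 ?_
    revert i j
    decide
  · have union : returnImage g E (cell g E ε w 0 ∪ cell g E ε w 1)
        = returnImage g E (cell g E ε w 0) ∪ returnImage g E (cell g E ε w 1) := by
      ext q
      simp only [returnImage, Set.mem_union, Set.mem_ofPred_eq, or_and_right, exists_or]
    rw [union, Set.union_inter_distrib_right, imL, imR]
    ext q
    simp only [Set.mem_union, Set.mem_iUnion, Fin.exists_fin_succ, Fin.exists_fin_zero]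
    simp [stripSource, stripShift, or_assoc]
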